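/- **Corollary 1 (existence and uniqueness).** *Setting.* Let $A$ be a nonempty countable alphabet, with its letters enumerated (so that they are ordered). A past is $\underline a=\ldots a_{-2}a_{-1}\in A^{-\mathbb N}$; a string is a finite or infinite string of past symbols, and $\underline z\,l$ denotes the past $\underline z$ followed by the more recent symbols $l$. Let $P(a|\underline a)$ be a (measurable) transition probability kernel from $A^{-\mathbb N}$ to $A$. For a finite string $l$ put $p(a|l)=\inf_{\underline z}P(a|\underline z\,l)$, and put $$\alpha(a)=\inf_{\underline z}P(a|\underline z),\qquad \alpha_{-1}=\sum_{a\in A}\alpha(a),\qquad \omega_k(\underline b)=\sum_{a\in A}p(a|b_{-k}^{-1}).$$ Assume that $P$ is weakly non-null: $\alpha_{-1}>0$. A past $\underline b$ is a *continuity point* of $P$ if $\omega_k(\underline b)\to1$. *Skeletons.* A *context tree* is a set $\tau$ of finite or infinite strings, none of them a proper suffix of another one, such that every past $\underline a$ has exactly one suffix $c_\tau(\underline a)$ in $\tau$. It is a *skeleton* if it is the smallest context tree that contains its infinite contexts (for every other such tree $\sigma$, $|c_\tau(\underline a)|\le|c_\sigma(\underline a)|$ for all $\underline a$), or if it consists of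 the empty string only. For a finite $v\in\tau$ put $\alpha_k^v=\inf_{w\in A^k}\sum_{a}p(a|w\,v)$, and put $\alpha_k^i=\inf\{\alpha_k^v: v\in\tau \text{ finite},\ |v|\le i\}$. Let $\tau$ be a skeleton such that $P$ is *locally continuous* with respect to $\tau$: $\alpha_k^v\to1$ as $k\to\infty$ for every finite $v\in\tau$. *Good coalescence times.* Let $\mathbf U=(U_i)_{i\in\mathbb Z}$ be i.i.d. and uniform on $[0,1)$ under $\mathbb P$. Let $Y_i=a$ if $\sum_{b<a}\alpha(b)\le U_i<\sum_{b\le a}\alpha(b)$, and $Y_i=\star$ if $U_i\ge\alpha_{-1}$. For $\mathbf a\in A^{\mathbb Z}$ let $Y_i(\mathbf a)=Y_i$ if $Y_i\in A$ and $Y_i(\mathbf a)=a_i$ if $Y_i=\star$, and let $c_\tau^n=\sup_{\mathbf a}|c_\tau(Y_{-\infty}^n(\mathbf a))|$. Let $$\bar\theta[0]=\sup\{i\le0:\ \text{for every } j=i,\ldots,0,\ \ Y_j\in A\ \text{ or }\ c_\tau^{j-1}\le j-i\},$$ and assume that $(\tau,p)$ is *good*: $\mathbb E|\bar\theta[0]|<\infty$.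 Put $A_0=\alpha_{-1}$ and, for $k\ge1$, $$A_k=\bigl\{1-(\mathbb E|\bar\theta[0]|+1)\,\mathbb P(U_0>\alpha_k^{c_\tau^{-1}})\bigr\}\vee\alpha_{-1}.$$ *Coupling from the past.* Given $\underline a$, partition $[0,1)$ into consecutive left-closed, right-open intervals $I_k(a|\underline a)$, ordered first by $k=0,1,\ldots,\infty$ and then by $a\in A$, of lengths $\alpha(a)$ for $k=0$, $p(a|a_{-k}^{-1})-p(a|a_{-k+1}^{-1})$ for $1\le k<\infty$, and $P(a|\underline a)-\lim_{k}p(a|a_{-k}^{-1})$ for $k=\infty$. Let $F(\underline a,u)$ be the letter $a$ for which $u\in\bigcup_{0\le k\le\infty}I_k(a|\underline a)$. For $j\le n$ let $F_{[j,n]}(\underline a,U_j^n)$ be the symbol at time $n$ that is obtained by starting from the past $\underline a$ before time $j$ and generating successively the symbols at times $i=j,\ldots,n$ by applying $F$ to the current past and $U_i$. Let $$\theta[n]=\max\{j\le n:\ F_{[j,n]}(\underline a,U_j^n)\text{ does not depend on }\underline a\},\qquad [\Phi(\mathbf U)]_i=F_{[\theta[i],i]}(\underline a,U_{\theta[i]}^i).$$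 *Statement.* Assume that one of the following holds: 1. $\sum_{k\ge1}\prod_{j=0}^{k-1}A_j=+\infty$; 2. $\sum_{k\ge0}(1-A_k)<+\infty$; 3. there are $D>0$ and $d\in(0,1)$ with $\mathbb P(|\bar\theta[0]|\ge n)\le Dd^n$ for all $n\ge0$, and there are $D'>0$ and $d'\in(0,1)$ with $1-A_k\le D'd'^k$ for all $k\ge0$. Then almost surely $\theta[i]>-\infty$ for all $i\in\mathbb Z$, so that the chain $\mathbf X=\Phi(\mathbf U)$ is almost surely well defined. It is stationary and compatible with $P$: its law $\mu=\mathbb P(\Phi(\mathbf U)\in\cdot)$ on $A^{\mathbb Z}$ is shift-invariant, and $\mu(X_0=a\,|\,X_{-\infty}^{-1})=P(a|X_{-\infty}^{-1})$ $\mu$-a.s. for every $a\in A$. Moreover $\mu$ is the only shift-invariant probability measure on $A^{\mathbb Z}$ that is compatible with $P$, and $\mu$-almost surely the past $X_{-\infty}^{-1}$ is a continuity point of $P$. -/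

import Mathlib

open MeasureTheory ProbabilityTheory Filter Topology
open scoped ENNReal

noncomputable section

namespace ChainCFTP

/-! Pasts and strings. A past `... a₋₂ a₋₁` is the function `n ↦ a₋₍ₙ₊₁₎` on `ℕ`; a finite string
`a₋ₖ ... a₋₁` is the list `[a₋₁, ..., a₋ₖ]`. So everything is read from the most recent symbol
backwards, and a suffix of a past is an initial segment of the function. -/

/-- Infinite pasts. -/
abbrev Past (A : Type*) := ℕ → A

/-- Finite or infinite strings of past symbols. -/
abbrev Str (A : Type*) := List A ⊕ Past A

/-- The past with most recent symbol `b`, preceded by `x`. -/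
def cons {A : Type*} (b : A) (x : Past A) : Past A
  | 0 => b
  | n + 1 => x n

/-- The past whose most recent symbols are the string `l`, preceded by `z`. -/
def cat {A : Type*} : List A → Past A → Past A
  | [], z => z
  | b :: l, z => cons b (cat l z)

/-- The string of the `k` most recent symbols of `x`. -/
def recent {A : Type*} (k : ℕ) (x : Past A) : List A := (List.range k).map x

/-- The past `x_{-∞}^n` (the symbol at time `n` included) of a two-sided sequence. -/
def pastUpTo {A : Type*} (x : ℤ → A) (n : ℤ) : Past A := fun k => x (n - k)

/-! Quantities attached to a transition kernel. -/

section Kernel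

variable {A : Type*} [MeasurableSpace A]

/-- `inf_z P(a | l z)`, where `l` are the most recent symbols. -/
def infP (P : Kernel (Past A) A) (l : List A) (a : A) : ℝ≥0∞ := ⨅ z : Past A, P (cat l z) {a}

/-- `α(a) = inf_z P(a | z)`. -/
def alpha (P : Kernel (Past A) A) (a : A) : ℝ≥0∞ := ⨅ z : Past A, P z {a}

/-- `α₋₁ = ∑ₐ α(a)`. -/
def alphaNeg (P : Kernel (Past A) A) : ℝ≥0∞ := ∑' a, alpha P a

/-- `P` is weakly non-null. -/
def WeaklyNonNull (P : Kernel (Past A) A) : Prop := 0 < alphaNeg P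

/-- `ωₖ(x) = ∑ₐ inf_z P(a | x₋ₖ ... x₋₁ z)`. -/
def omegaK (P : Kernel (Past A) A) (x : Past A) (k : ℕ) : ℝ≥0∞ := ∑' a, infP P (recent k x) a

/-- `x` is a continuity point of `P`. -/
def IsContinuityPoint (P : Kernel (Past A) A) (x : Past A) : Prop :=
  Tendsto (omegaK P x) atTop (𝓝 1)

/-- `αₖᵛ`: the infimum, over the strings `w` of `k` symbols that precede `v`, of
`∑ₐ inf_z P(a | v w z)`. -/
def alphaStr (P : Kernel (Past A) A) (v : List A) (k : ℕ) : ℝ≥0∞ :=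
  ⨅ (w : List A) (_ : w.length = k), ∑' a, infP P (v ++ w) a

/-- Stationarity of a measure on two-sided sequences. -/
def IsStationaryLaw (μ : Measure (ℤ → A)) : Prop := μ.map (fun x i => x (i + 1)) = μ

/-- `P` is a version of the conditional probability of the symbol at time `0` given
the strict past. -/
def IsCompatible (P : Kernel (Past A) A) (μ : Measure (ℤ → A)) : Prop :=
  ∀ a : A,
    μ[Set.indicator {x : ℤ → A | x 0 = a} (fun _ => (1 : ℝ)) |
        MeasurableSpace.comap (fun x : ℤ → A => pastUpTo x (-1)) inferInstance]
      =ᵐ[μ] fun x => (P (pastUpTo x (-1))).real {a}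

end Kernel

/-! Context trees and skeletons. -/

section Trees

variable {A : Type*}

/-- Length of a finite or infinite string. -/
def strLen : Str A → ℕ∞
  | Sum.inl l => l.length
  | Sum.inr _ => ⊤

/-- The string `v` is a suffix of the past `x`. -/
def IsSuffixOf : Str A → Past A → Prop
  | Sum.inl l, x => ∃ z, x = cat l z
  | Sum.inr y, x => x = y

/-- Context trees: every past has exactly one suffix in `τ`, and no element of `τ` is a proper
suffix of another one. -/
structure IsContextTree (τ : Set (Str A)) : Prop where
  partition : ∀ x : Past A, ∃! v : Str A, v ∈ τ ∧ IsSuffixOf v x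
  no_finite_extension : ∀ v w : List A, Sum.inl v ∈ τ → w ≠ [] → Sum.inl (v ++ w) ∉ τ
  no_infinite_extension : ∀ (v : List A) (z : Past A), Sum.inl v ∈ τ → Sum.inr (cat v z) ∉ τ

/-- `c_τ(x)`, the element of `τ` that is a suffix of `x`. -/
def context (τ : Set (Str A)) (x : Past A) : Str A :=
  Classical.epsilon fun v => v ∈ τ ∧ IsSuffixOf v x

/-- `|c_τ(x)|`. -/
def contextLen (τ : Set (Str A)) (x : Past A) : ℕ∞ := strLen (context τ x)

/-- Skeletons: the smallest context tree (that is, the one with the shortest contexts) among those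
containing the infinite contexts of `τ`; the tree reduced to the empty string is one of them. -/
def IsSkeleton (τ : Set (Str A)) : Prop :=
  IsContextTree τ ∧
    ((∀ σ : Set (Str A), IsContextTree σ →
        (∀ y : Past A, Sum.inr y ∈ τ → Sum.inr y ∈ σ) →
        ∀ x : Past A, contextLen τ x ≤ contextLen σ x) ∨
      τ = {Sum.inl []})

variable [MeasurableSpace A]

/-- `P` is locally continuous with respect to `τ`. -/
def LocallyContinuous (P : Kernel (Past A) A) (τ : Set (Str A)) : Prop :=
  ∀ v : List A, Sum.inl v ∈ τ → Tendsto (alphaStr P v) atTop (𝓝 1)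

/-- `αₖⁱ`, the infimum of `αₖᵛ` over the finite contexts `v` of `τ` of length at most `i`. -/
def alphaLen (P : Kernel (Past A) A) (τ : Set (Str A)) (k : ℕ) (i : ℕ∞) : ℝ≥0∞ :=
  ⨅ (v : List A) (_ : Sum.inl v ∈ τ) (_ : (v.length : ℕ∞) ≤ i), alphaStr P v k

end Trees

/-! The partition of `[0,1)` and the update function. The letters are ordered by an enumeration
`e`. -/

section Update

variable {A : Type*}

/-- The intervals of lengths `ℓ a`, `a ∈ A`, are put one after the other, in the order of the
enumeration `e` and starting at `base`; this is the one that belongs to `a`. -/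
def slot (e : A ↪ ℕ) (base : ℝ≥0∞) (ℓ : A → ℝ≥0∞) (a : A) : Set ℝ :=
  {u | 0 ≤ u ∧ ENNReal.ofReal u ∈
    Set.Ico (base + ∑' b, if e b < e a then ℓ b else 0)
      (base + (∑' b, if e b < e a then ℓ b else 0) + ℓ a)}

variable [MeasurableSpace A]

/-- The length of `Iₖ(a | x₋ₖ ... x₋₁)`. -/
def pieceLen (P : Kernel (Past A) A) (x : Past A) : ℕ → A → ℝ≥0∞
  | 0, a => alpha P a
  | k + 1, a => infP P (recent (k + 1) x) a - infP P (recent k x) a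

/-- The length of `I_∞(a | x)`; the limit over `k` is nondecreasing, so it is a supremum. -/
def pieceLenInfty (P : Kernel (Past A) A) (x : Past A) (a : A) : ℝ≥0∞ :=
  P x {a} - ⨆ k : ℕ, infP P (recent k x) a

/-- `Iₖ(a | x₋ₖ ... x₋₁)`: all the intervals with a smaller index `k` come first. -/
def piece (e : A ↪ ℕ) (P : Kernel (Past A) A) (x : Past A) (k : ℕ) (a : A) : Set ℝ :=
  slot e (∑ j ∈ Finset.range k, ∑' b, pieceLen P x j b) (pieceLen P x k) a

/-- `I_∞(a | x)`: it comes after all the intervals with a finite index. -/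
def pieceInfty (e : A ↪ ℕ) (P : Kernel (Past A) A) (x : Past A) (a : A) : Set ℝ :=
  slot e (∑' j : ℕ, ∑' b, pieceLen P x j b) (pieceLenInfty P x) a

/-- The update function: `F(x,u)` is the letter `a` such that `u` lies in one of the intervals
`I₀(a), I₁(a | x₋₁), ..., I_∞(a | x)`. For `u ∈ [0,1)` there is exactly one. -/
def updateFn [Nonempty A] (e : A ↪ ℕ) (P : Kernel (Past A) A) (x : Past A) (u : ℝ) : A :=
  Classical.epsilon fun a => (∃ k : ℕ, u ∈ piece e P x k a) ∨ u ∈ pieceInfty e P x a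

end Update

/-! Coupling from the past for an update function `F`, driven by `u ∈ ℝ^ℤ`. -/

section CFTP

variable {A : Type*}

/-- The past obtained from the past `x` (before time `k`) by generating with `F` the `n` symbols at
times `k, ..., k + n - 1`. -/
def run (F : Past A → ℝ → A) (u : ℤ → ℝ) (k : ℤ) (x : Past A) : ℕ → Past A
  | 0 => x
  | n + 1 => cons (F (run F u k x n) (u (k + n))) (run F u k x n)

/-- `F_{[k,l]}(x, u_k^l)` for `k ≤ l`. -/
def iterF (F : Past A → ℝ → A) (u : ℤ → ℝ) (k l : ℤ) (x : Past A) : A :=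
  F (run F u k x (l - k).toNat) (u l)

/-- The times `j ≤ n` for which `F_{[j,n]}(x, u_j^n)` does not depend on `x`. -/
def coalescenceSet (F : Past A → ℝ → A) (u : ℤ → ℝ) (n : ℤ) : Set ℤ :=
  {j | j ≤ n ∧ ∀ x y : Past A, iterF F u j n x = iterF F u j n y}

/-- The coalescence time `θ[n]`: the maximum of the coalescence set, when it is not empty. -/
def theta (F : Past A → ℝ → A) (u : ℤ → ℝ) (n : ℤ) : ℤ := sSup (coalescenceSet F u n)

/-- The reconstruction function: `Φ(u)ᵢ = F_{[θ[i],i]}(x, u)`, for any `x`. -/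
def Phi [Nonempty A] (F : Past A → ℝ → A) (u : ℤ → ℝ) (i : ℤ) : A :=
  iterF F u (theta F u i) i (fun _ => Classical.arbitrary A)

end CFTP

/-! Good skeletons. -/

section Good

variable {A : Type*} [MeasurableSpace A]

open Classical in
/-- The variable `Yᵢ` as a function of `Uᵢ = u`: the letter whose interval contains `u` in
`[0, α₋₁)`, and `⋆` (that is, `none`) for `u ≥ α₋₁`. -/
def letterOf (e : A ↪ ℕ) (P : Kernel (Past A) A) (u : ℝ) : Option A :=
  if h : ∃ a, u ∈ slot e 0 (alpha P) a then some h.choose else none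

/-- `c_τⁿ = sup_a |c_τ(Y_{-∞}^n(a))|`, where `Y(a)` is `Y` with the symbols `⋆` replaced by those
of `a`. -/
def maxContextLen (τ : Set (Str A)) (Y : ℤ → Option A) (n : ℤ) : ℕ∞ :=
  ⨆ a : ℤ → A, contextLen τ (pastUpTo (fun i => (Y i).getD (a i)) n)

/-- The good coalescence times for time `m`. -/
def goodTimes (τ : Set (Str A)) (Y : ℤ → Option A) (m : ℤ) : Set ℤ :=
  {i | i ≤ m ∧ ∀ j, i ≤ j → j ≤ m →
    (∃ a, Y j = some a) ∨ maxContextLen τ Y (j - 1) ≤ ((j - i).toNat : ℕ∞)}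

/-- `|θ̄[0]|`, where `θ̄[0] ≤ 0` is the largest good coalescence time for time `0`; it is infinite
if there is none. -/
def absThetaBar (τ : Set (Str A)) (Y : ℤ → Option A) : ℕ∞ :=
  ⨅ i ∈ goodTimes τ Y 0, (i.natAbs : ℕ∞)

variable {Ω : Type*} [MeasurableSpace Ω]

/-- The sequence `U` is i.i.d. and uniform on `[0,1)`. -/
structure IsIIDUniform (Pr : Measure Ω) (U : ℤ → Ω → ℝ) : Prop where
  measurable : ∀ i, Measurable (U i)
  indep : iIndepFun U Pr
  law : ∀ i, Pr.map (U i) = volume.restrict (Set.Ico (0 : ℝ) 1)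

/-- `|θ̄[0]|` as a random variable. -/
def goodTime (e : A ↪ ℕ) (P : Kernel (Past A) A) (τ : Set (Str A)) (U : ℤ → Ω → ℝ) (ω : Ω) : ℕ∞ :=
  absThetaBar τ fun i => letterOf e P (U i ω)

/-- `𝔼|θ̄[0]|`. -/
def meanGoodTime (e : A ↪ ℕ) (P : Kernel (Past A) A) (τ : Set (Str A)) (Pr : Measure Ω)
    (U : ℤ → Ω → ℝ) : ℝ≥0∞ :=
  ∫⁻ ω, (goodTime e P τ U ω : ℝ≥0∞) ∂Pr

/-- The probabilistic skeleton of `P` on `τ` is good. -/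
def IsGood (e : A ↪ ℕ) (P : Kernel (Past A) A) (τ : Set (Str A)) (Pr : Measure Ω)
    (U : ℤ → Ω → ℝ) : Prop :=
  meanGoodTime e P τ Pr U < ⊤

/-- The sequence `A₀ = α₋₁` and, for `k ≥ 1`,
`Aₖ = max (1 - (𝔼|θ̄[0]| + 1) ℙ(U₀ > αₖ^{c_τ⁻¹})) α₋₁`. The subtraction is truncated at `0`, which
does not change the maximum. -/
def seqA (e : A ↪ ℕ) (P : Kernel (Past A) A) (τ : Set (Str A)) (Pr : Measure Ω)
    (U : ℤ → Ω → ℝ) : ℕ → ℝ≥0∞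
  | 0 => alphaNeg P
  | k + 1 =>
    max (1 - (meanGoodTime e P τ Pr U + 1) *
        Pr {ω | alphaLen P τ (k + 1) (maxContextLen τ (fun i => letterOf e P (U i ω)) (-1))
          < ENNReal.ofReal (U 0 ω)})
      (alphaNeg P)

/-- Exponential decay to zero. -/
def ExpDecay (c : ℕ → ℝ≥0∞) : Prop :=
  ∃ D d : ℝ, 0 < D ∧ 0 < d ∧ d < 1 ∧ ∀ n, c n ≤ ENNReal.ofReal (D * d ^ n)

/-- First regime: `∑_{k ≥ 1} ∏_{j < k} Aⱼ = ∞`. -/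
def RegimeOne (e : A ↪ ℕ) (P : Kernel (Past A) A) (τ : Set (Str A)) (Pr : Measure Ω)
    (U : ℤ → Ω → ℝ) : Prop :=
  ∑' k : ℕ, ∏ j ∈ Finset.range (k + 1), seqA e P τ Pr U j = ⊤

/-- Second regime: `∑_{k ≥ 0} (1 - Aₖ) < ∞`. -/
def RegimeTwo (e : A ↪ ℕ) (P : Kernel (Past A) A) (τ : Set (Str A)) (Pr : Measure Ω)
    (U : ℤ → Ω → ℝ) : Prop :=
  ∑' k : ℕ, (1 - seqA e P τ Pr U k) < ⊤

/-- Third regime: `θ̄[0]` has exponential tail and `1 - Aₖ` decays exponentially fast. -/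
def RegimeThree (e : A ↪ ℕ) (P : Kernel (Past A) A) (τ : Set (Str A)) (Pr : Measure Ω)
    (U : ℤ → Ω → ℝ) : Prop :=
  ExpDecay (fun n => Pr {ω | (n : ℕ∞) ≤ goodTime e P τ U ω}) ∧
    ExpDecay (fun k => 1 - seqA e P τ Pr U k)

/-- The chain `X = Φ(U)` built by coupling from the past with the update function of `P`. -/
def chainX [Nonempty A] (e : A ↪ ℕ) (P : Kernel (Past A) A) (U : ℤ → Ω → ℝ) (ω : Ω) : ℤ → A :=
  Phi (updateFn e P) fun i => U i ω

end Good

end ChainCFTP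

end

open ChainCFTP

/-!
Coupling from the past for chains of infinite order with a good skeleton.

Say that a letter is known at time `i` when `U_i < α₋₁`. A good coalescence time `θ̄[0]` cuts off a
block `[θ̄[0], 0]` in which, whenever the letter at time `j` is not known, the context of the past at
time `j` is determined by the known letters of the block (`lt_omegaK_of_mem_blockSet`). The symbol
at such a time depends then on this context and on `k` more symbols as soon as
`U_j < αₖ^{c_τ^{j-1}}`. Say that a block needs at most `k` more symbols when, at each of its times,
the letter is known or `k ≥ 1` and this inequality holds. If
the last of `n` successive blocks, read backwards from time `0`, needs no more symbols, the one
before needs at most `1`, ..., and the first one needs at most `n - 1`, then the run over these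
blocks forgets its starting past (`run_congr_of_mem_chainSet`): this is a renewal.

That a block reaches back beyond time `-n` depends on `U` after `-n`, and that the update
at time `-n` fits depends on `U` up to `-n`. By this independence, the expected number of misfits in
a block is at most `(𝔼|θ̄[0]| + 1) ℙ(U₀ > αₖ^{c_τ⁻¹})`, so a block needs at most `k` more symbols with
probability at least `Aₖ` (`seqA_le_tsum_blockSet`). What a block needs is a function of the driving
variables in the block, so successive blocks are independent and the expected number of
renewals is at least `∑ₖ ∏_{j<k} Aⱼ`. Each of the three regimes makes this sum infinite
(`regimeOne_of_regimes`), and then decomposing according to the last renewal shows that a renewal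
occurs almost surely (`drivingLaw_compl_renewalSet`).

A renewal for the blocks ending at time `i` gives coalescence at time `i`, and also
`U_i < ω_K(X_{-∞}^{i-1})` for some `K`. The second fact makes `X_i = F(X_{-∞}^{i-1}, U_i)`
(`Phi_eq_updateFn`), although `F` need not be continuous, and so `X` is compatible with `P`; as
`U_0` is independent of `X_{-∞}^{-1}`, it also forces `sup_k ω_k(X_{-∞}^{-1}) = 1`
(`ae_isContinuityPoint`). For uniqueness, the law of the past of a stationary compatible law is
invariant under `(x, u) ↦ cons (F x u) x`, and the runs started from it in the remote past
have, by coalescence, the symbols of `X` (`eq_pastLaw_of_invariant`).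
-/

namespace ChainCFTP

/-! ### Strings and pasts -/

section Strings

variable {A : Type*}

lemma length_recent (k : ℕ) (x : Past A) : (recent k x).length = k := by simp [recent]

lemma recent_eq_iff {k : ℕ} {x y : Past A} : recent k x = recent k y ↔ ∀ i < k, x i = y i := by
  simp [recent]

lemma recent_add (m n : ℕ) (x : Past A) :
    recent (m + n) x = recent m x ++ recent n (fun i => x (m + i)) := by
  simp [recent, List.range_add, Function.comp_def]

lemma cat_append (l l' : List A) (z : Past A) : cat (l ++ l') z = cat l (cat l' z) := by
  induction l with
  | nil => rfl
  | cons b l ih => simp [cat, ih]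

lemma recent_succ_cons (k : ℕ) (b : A) (x : Past A) :
    recent (k + 1) (cons b x) = b :: recent k x := by
  simp only [recent, List.range_succ_eq_map, List.map_cons, List.map_map]
  rfl

lemma cons_head_tail (x : Past A) : cons (x 0) (fun n => x (n + 1)) = x := by
  funext n; cases n <;> rfl

lemma recent_cat (l : List A) (z : Past A) : recent l.length (cat l z) = l := by
  induction l with
  | nil => rfl
  | cons b l ih => rw [List.length_cons, cat, recent_succ_cons, ih]

lemma cat_recent (k : ℕ) (x : Past A) : cat (recent k x) (fun n => x (k + n)) = x := by
  induction k generalizing x with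
  | zero => simp [recent, cat]
  | succ k ih =>
    conv_rhs => rw [← cons_head_tail x, ← ih (fun n => x (n + 1))]
    conv_lhs => rw [← cons_head_tail x, recent_succ_cons]
    simp only [cat]
    congr 2
    funext n
    rw [cons_head_tail]
    congr 1
    omega

lemma isSuffixOf_inl_iff {l : List A} {x : Past A} :
    IsSuffixOf (Sum.inl l) x ↔ recent l.length x = l := by
  constructor
  · rintro ⟨z, rfl⟩
    exact recent_cat l z
  · intro h
    exact ⟨fun n => x (l.length + n), by conv_lhs => rw [← cat_recent l.length x, h]⟩

end Strings

/-! ### Consecutive intervals ordered by an enumeration of the letters -/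

section Slots

variable {A : Type*}

/-- Total length of the intervals of the letters that are enumerated before `n`. -/
noncomputable def ladder (e : A ↪ ℕ) (ℓ : A → ℝ≥0∞) (n : ℕ) : ℝ≥0∞ :=
  ∑' b, if e b < n then ℓ b else 0

lemma mem_slot {e : A ↪ ℕ} {base : ℝ≥0∞} {ℓ : A → ℝ≥0∞} {a : A} {u : ℝ} :
    u ∈ slot e base ℓ a ↔ 0 ≤ u ∧ base + ladder e ℓ (e a) ≤ ENNReal.ofReal u ∧
      ENNReal.ofReal u < base + ladder e ℓ (e a) + ℓ a := Iff.rfl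

lemma ladder_mono (e : A ↪ ℕ) (ℓ : A → ℝ≥0∞) : Monotone (ladder e ℓ) := by
  intro m n h
  refine ENNReal.tsum_le_tsum fun b => ?_
  split_ifs <;> first | exact le_rfl | exact zero_le | omega

lemma ladder_le_tsum (e : A ↪ ℕ) (ℓ : A → ℝ≥0∞) (n : ℕ) : ladder e ℓ n ≤ ∑' b, ℓ b :=
  ENNReal.tsum_le_tsum fun b => by split_ifs <;> simp

lemma ladder_succ (e : A ↪ ℕ) (ℓ : A → ℝ≥0∞) (a : A) :
    ladder e ℓ (e a + 1) = ladder e ℓ (e a) + ℓ a := by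
  classical
  rw [← tsum_ite_eq a ℓ]
  unfold ladder
  rw [← ENNReal.tsum_add]
  refine tsum_congr fun b => ?_
  rcases eq_or_ne b a with rfl | h
  · simp
  · have : e b ≠ e a := fun h' => h (e.injective h')
    have h2 : e b < e a + 1 ↔ e b < e a := by omega
    simp [h2, h]

lemma ladder_succ_of_forall_ne (e : A ↪ ℕ) (ℓ : A → ℝ≥0∞) {n : ℕ} (h : ∀ a, e a ≠ n) :
    ladder e ℓ (n + 1) = ladder e ℓ n := by
  refine tsum_congr fun b => ?_
  have := h b
  have h2 : e b < n + 1 ↔ e b < n := by omega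
  simp [h2]

lemma slot_unique {e : A ↪ ℕ} {base : ℝ≥0∞} {ℓ : A → ℝ≥0∞} {a b : A} {u : ℝ}
    (ha : u ∈ slot e base ℓ a) (hb : u ∈ slot e base ℓ b) : a = b := by
  have key : ∀ {a b : A}, u ∈ slot e base ℓ a → u ∈ slot e base ℓ b → ¬ e a < e b := by
    intro a b ha hb hab
    rw [mem_slot] at ha hb
    refine absurd (ha.2.2.trans_le ?_) (not_lt.2 hb.2.1)
    rw [add_assoc, ← ladder_succ]
    gcongr
    exact ladder_mono e ℓ hab
  exact e.injective (le_antisymm (not_lt.1 (key hb ha)) (not_lt.1 (key ha hb)))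

lemma slot_le {e : A ↪ ℕ} {base : ℝ≥0∞} {ℓ : A → ℝ≥0∞} {a : A} {u : ℝ}
    (h : u ∈ slot e base ℓ a) : base ≤ ENNReal.ofReal u :=
  le_self_add.trans (mem_slot.1 h).2.1

lemma slot_lt {e : A ↪ ℕ} {base : ℝ≥0∞} {ℓ : A → ℝ≥0∞} {a : A} {u : ℝ}
    (h : u ∈ slot e base ℓ a) : ENNReal.ofReal u < base + ∑' b, ℓ b := by
  refine (mem_slot.1 h).2.2.trans_le ?_
  rw [add_assoc, ← ladder_succ]
  gcongr
  exact ladder_le_tsum _ _ _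

/-- The slots that start at `base` exhaust the interval `[base, base + ∑ ℓ)`. -/
lemma exists_mem_slot (e : A ↪ ℕ) {base : ℝ≥0∞} {ℓ : A → ℝ≥0∞} {u : ℝ} (hu : 0 ≤ u)
    (h1 : base ≤ ENNReal.ofReal u) (h2 : ENNReal.ofReal u < base + ∑' b, ℓ b) :
    ∃ a, u ∈ slot e base ℓ a := by
  classical
  have hex : ∃ n, ENNReal.ofReal u < base + ladder e ℓ n := by
    by_contra! hcon
    refine absurd h2 (not_lt.2 ?_)
    rw [ENNReal.tsum_eq_iSup_sum, ENNReal.add_iSup]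
    refine iSup_le fun s => le_trans ?_ (hcon (s.sup e + 1))
    gcongr
    calc ∑ a ∈ s, ℓ a = ∑ b ∈ s, if e b < s.sup e + 1 then ℓ b else 0 := by
          refine Finset.sum_congr rfl fun b hb => ?_
          rw [if_pos (Nat.lt_succ_of_le (Finset.le_sup (f := e) hb))]
      _ ≤ _ := ENNReal.sum_le_tsum s
  obtain ⟨m, hm⟩ : ∃ m, Nat.find hex = m + 1 := by
    refine Nat.exists_eq_succ_of_ne_zero fun h0 => ?_
    have := Nat.find_spec hex
    rw [h0] at this
    simp only [ladder, not_lt_zero, if_false, tsum_zero, add_zero] at this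
    exact absurd this (not_lt.2 h1)
  have hspec := Nat.find_spec hex
  have hmin : base + ladder e ℓ m ≤ ENNReal.ofReal u :=
    not_lt.1 (Nat.find_min hex (by omega))
  rw [hm] at hspec
  by_cases h : ∃ a, e a = m
  · obtain ⟨a, rfl⟩ := h
    refine ⟨a, mem_slot.2 ⟨hu, hmin, ?_⟩⟩
    rwa [add_assoc, ← ladder_succ]
  · push Not at h
    rw [ladder_succ_of_forall_ne e ℓ h] at hspec
    exact absurd hspec (not_lt.2 hmin)

lemma volume_slot {e : A ↪ ℕ} {base : ℝ≥0∞} {ℓ : A → ℝ≥0∞} (h : base + ∑' b, ℓ b ≤ 1) (a : A) :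
    volume (slot e base ℓ a) = ℓ a := by
  set c := base + ladder e ℓ (e a) with hc
  have hd : c + ℓ a ≤ 1 := by
    refine le_trans ?_ h
    rw [hc, add_assoc, ← ladder_succ]
    gcongr
    exact ladder_le_tsum _ _ _
  have hd' : c + ℓ a ≠ ⊤ := ne_top_of_le_ne_top ENNReal.one_ne_top hd
  have hc' : c ≠ ⊤ := ne_top_of_le_ne_top hd' le_self_add
  have hl' : ℓ a ≠ ⊤ := ne_top_of_le_ne_top hd' le_add_self
  have : slot e base ℓ a = Set.Ico c.toReal (c + ℓ a).toReal := by
    ext u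
    rw [mem_slot, Set.mem_Ico]
    constructor
    · rintro ⟨h0, h1, h2⟩
      exact ⟨ENNReal.toReal_le_of_le_ofReal h0 h1, (ENNReal.ofReal_lt_iff_lt_toReal h0 hd').1 h2⟩
    · rintro ⟨h1, h2⟩
      have h0 : 0 ≤ u := ENNReal.toReal_nonneg.trans h1
      exact ⟨h0, (ENNReal.le_ofReal_iff_toReal_le hc' h0).2 h1,
        (ENNReal.ofReal_lt_iff_lt_toReal h0 hd').2 h2⟩
  rw [this, Real.volume_Ico, ENNReal.toReal_add hc' hl', add_sub_cancel_left,
    ENNReal.ofReal_toReal hl']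

end Slots

/-! ### The update function -/

section Update

variable {A : Type*} [MeasurableSpace A]

lemma infP_le (P : Kernel (Past A) A) (k : ℕ) (x : Past A) (a : A) :
    infP P (recent k x) a ≤ P x {a} := by
  refine (iInf_le _ (fun n => x (k + n))).trans ?_
  rw [cat_recent]

lemma infP_append_le (P : Kernel (Past A) A) (l l' : List A) (a : A) :
    infP P l a ≤ infP P (l ++ l') a := by
  refine le_iInf fun z => ?_
  rw [cat_append]
  exact iInf_le _ _

lemma infP_recent_mono (P : Kernel (Past A) A) (x : Past A) (a : A) :
    Monotone fun k => infP P (recent k x) a := by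
  refine monotone_nat_of_le_succ fun k => ?_
  rw [recent_add]
  exact infP_append_le _ _ _ _

lemma omegaK_mono (P : Kernel (Past A) A) (x : Past A) : Monotone (omegaK P x) :=
  fun _ _ h => ENNReal.tsum_le_tsum fun a => infP_recent_mono P x a h

lemma omegaK_zero (P : Kernel (Past A) A) (x : Past A) : omegaK P x 0 = alphaNeg P := rfl

lemma tsum_kernel_singleton [Countable A] [MeasurableSingletonClass A] (P : Kernel (Past A) A)
    [IsMarkovKernel P] (x : Past A) : ∑' a, P x {a} = 1 := by
  have := (P x).tsum_indicator_apply_singleton Set.univ MeasurableSet.univ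
  simpa using this

lemma omegaK_le_one [Countable A] [MeasurableSingletonClass A] (P : Kernel (Past A) A)
    [IsMarkovKernel P] (x : Past A) (k : ℕ) : omegaK P x k ≤ 1 := by
  rw [← tsum_kernel_singleton P x]
  exact ENNReal.tsum_le_tsum fun a => infP_le P k x a

lemma infP_eq_sum_pieceLen (P : Kernel (Past A) A) (x : Past A) (a : A) (k : ℕ) :
    infP P (recent k x) a = ∑ j ∈ Finset.range (k + 1), pieceLen P x j a := by
  induction k with
  | zero => simp [pieceLen, recent, infP, alpha, cat]
  | succ k ih =>
    rw [Finset.sum_range_succ, ← ih, pieceLen,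
      add_tsub_cancel_of_le (infP_recent_mono P x a (Nat.le_succ k))]

lemma sum_tsum_pieceLen (P : Kernel (Past A) A) (x : Past A) (k : ℕ) :
    ∑ j ∈ Finset.range (k + 1), ∑' b, pieceLen P x j b = omegaK P x k := by
  simp only [omegaK, infP_eq_sum_pieceLen]
  exact (Summable.tsum_finsetSum fun _ _ => ENNReal.summable).symm

lemma tsum_pieceLen (P : Kernel (Past A) A) (x : Past A) (a : A) :
    ∑' j, pieceLen P x j a = ⨆ k : ℕ, infP P (recent k x) a := by
  rw [ENNReal.tsum_eq_iSup_nat' (Filter.tendsto_add_atTop_nat 1)]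
  simp only [infP_eq_sum_pieceLen]

lemma tsum_pieceLen_add (P : Kernel (Past A) A) (x : Past A) (a : A) :
    ∑' j, pieceLen P x j a + pieceLenInfty P x a = P x {a} := by
  rw [tsum_pieceLen, pieceLenInfty]
  exact add_tsub_cancel_of_le (iSup_le fun k => infP_le P k x a)

lemma tsum_tsum_add [Countable A] [MeasurableSingletonClass A] (P : Kernel (Past A) A)
    [IsMarkovKernel P] (x : Past A) :
    ∑' j, ∑' b, pieceLen P x j b + ∑' b, pieceLenInfty P x b = 1 := by
  rw [ENNReal.tsum_comm, ← ENNReal.tsum_add]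
  simp_rw [tsum_pieceLen_add, tsum_kernel_singleton]

/-- The union over `k ≤ ∞` of the intervals `Iₖ(a | x)`. -/
def letterSet (e : A ↪ ℕ) (P : Kernel (Past A) A) (x : Past A) (a : A) : Set ℝ :=
  (⋃ k : ℕ, piece e P x k a) ∪ pieceInfty e P x a

lemma piece_lt_omegaK {e : A ↪ ℕ} {P : Kernel (Past A) A} {x : Past A} {k : ℕ} {a : A} {u : ℝ}
    (h : u ∈ piece e P x k a) : ENNReal.ofReal u < omegaK P x k := by
  have := slot_lt h
  rwa [← Finset.sum_range_succ (fun j => ∑' b, pieceLen P x j b), sum_tsum_pieceLen] at this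

lemma omegaK_le_of_mem_piece {e : A ↪ ℕ} {P : Kernel (Past A) A} {x : Past A} {k : ℕ} {a : A}
    {u : ℝ} (h : u ∈ piece e P x (k + 1) a) : omegaK P x k ≤ ENNReal.ofReal u := by
  rw [← sum_tsum_pieceLen]
  exact slot_le h

lemma omegaK_le_of_mem_pieceInfty {e : A ↪ ℕ} {P : Kernel (Past A) A} {x : Past A} {a : A}
    {u : ℝ} (k : ℕ) (h : u ∈ pieceInfty e P x a) : omegaK P x k ≤ ENNReal.ofReal u := by
  rw [← sum_tsum_pieceLen]
  exact (ENNReal.sum_le_tsum _).trans (slot_le h)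

lemma piece_index_unique {e : A ↪ ℕ} {P : Kernel (Past A) A} {x : Past A} {k k' : ℕ} {a b : A}
    {u : ℝ} (ha : u ∈ piece e P x k a) (hb : u ∈ piece e P x k' b) : k = k' := by
  have key : ∀ {k k' : ℕ} {a b : A}, u ∈ piece e P x k a → u ∈ piece e P x k' b → ¬ k < k' := by
    intro k k' a b ha hb hlt
    obtain ⟨m, rfl⟩ : ∃ m, k' = m + 1 := ⟨k' - 1, by omega⟩
    exact absurd ((piece_lt_omegaK ha).trans_le (omegaK_mono P x (Nat.lt_succ_iff.1 hlt)))
      (not_lt.2 (omegaK_le_of_mem_piece hb))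
  exact le_antisymm (not_lt.1 (key hb ha)) (not_lt.1 (key ha hb))

lemma disjoint_piece_pieceInfty {e : A ↪ ℕ} {P : Kernel (Past A) A} {x : Past A} {k : ℕ} {a b : A}
    {u : ℝ} (ha : u ∈ piece e P x k a) (hb : u ∈ pieceInfty e P x b) : False :=
  absurd (piece_lt_omegaK ha) (not_lt.2 (omegaK_le_of_mem_pieceInfty k hb))

lemma letterSet_unique {e : A ↪ ℕ} {P : Kernel (Past A) A} {x : Past A} {a b : A} {u : ℝ}
    (ha : u ∈ letterSet e P x a) (hb : u ∈ letterSet e P x b) : a = b := by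
  rcases ha with ha | ha <;> rcases hb with hb | hb
  · obtain ⟨k, hk⟩ := Set.mem_iUnion.1 ha
    obtain ⟨k', hk'⟩ := Set.mem_iUnion.1 hb
    obtain rfl := piece_index_unique hk hk'
    exact slot_unique hk hk'
  · exact (disjoint_piece_pieceInfty (Set.mem_iUnion.1 ha).choose_spec hb).elim
  · exact (disjoint_piece_pieceInfty (Set.mem_iUnion.1 hb).choose_spec ha).elim
  · exact slot_unique ha hb

lemma exists_mem_piece (e : A ↪ ℕ) (P : Kernel (Past A) A) (x : Past A) {k : ℕ} {u : ℝ}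
    (hu : 0 ≤ u) (h : ENNReal.ofReal u < omegaK P x k) : ∃ j ≤ k, ∃ a, u ∈ piece e P x j a := by
  induction k with
  | zero =>
    refine ⟨0, le_rfl, exists_mem_slot e hu (by simp) ?_⟩
    simpa [omegaK_zero, alphaNeg, pieceLen] using h
  | succ k ih =>
    rcases lt_or_ge (ENNReal.ofReal u) (omegaK P x k) with h' | h'
    · obtain ⟨j, hj, ha⟩ := ih h'
      exact ⟨j, hj.trans (Nat.le_succ k), ha⟩
    · refine ⟨k + 1, le_rfl, exists_mem_slot e hu ?_ ?_⟩
      · rwa [sum_tsum_pieceLen]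
      · rwa [← Finset.sum_range_succ (fun j => ∑' b, pieceLen P x j b), sum_tsum_pieceLen]

lemma exists_mem_letterSet [Countable A] [MeasurableSingletonClass A] (e : A ↪ ℕ)
    (P : Kernel (Past A) A) [IsMarkovKernel P] (x : Past A) {u : ℝ} (hu : 0 ≤ u) (hu1 : u < 1) :
    ∃ a, u ∈ letterSet e P x a := by
  by_cases h : ∃ k, ENNReal.ofReal u < omegaK P x k
  · obtain ⟨k, hk⟩ := h
    obtain ⟨j, -, a, ha⟩ := exists_mem_piece e P x hu hk
    exact ⟨a, Or.inl (Set.mem_iUnion.2 ⟨j, ha⟩)⟩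
  · push Not at h
    obtain ⟨a, ha⟩ : ∃ a, u ∈ pieceInfty e P x a := by
      refine exists_mem_slot e hu ?_ ?_
      · rw [ENNReal.tsum_eq_iSup_nat' (Filter.tendsto_add_atTop_nat 1)]
        exact iSup_le fun k => by rw [sum_tsum_pieceLen]; exact h k
      · rw [tsum_tsum_add]
        exact (ENNReal.ofReal_lt_one).2 hu1
    exact ⟨a, Or.inr ha⟩

lemma mem_Ico_of_mem_letterSet [Countable A] [MeasurableSingletonClass A] {e : A ↪ ℕ}
    {P : Kernel (Past A) A} [IsMarkovKernel P] {x : Past A} {a : A} {u : ℝ}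
    (h : u ∈ letterSet e P x a) : u ∈ Set.Ico (0 : ℝ) 1 := by
  rcases h with h | h
  · obtain ⟨k, hk⟩ := Set.mem_iUnion.1 h
    exact ⟨(mem_slot.1 hk).1,
      ENNReal.ofReal_lt_one.1 ((piece_lt_omegaK hk).trans_le (omegaK_le_one P x k))⟩
  · refine ⟨(mem_slot.1 h).1, ENNReal.ofReal_lt_one.1 ?_⟩
    rw [← tsum_tsum_add P x]
    exact slot_lt h

lemma updateFn_eq [Nonempty A] {e : A ↪ ℕ} {P : Kernel (Past A) A} {x : Past A} {a : A} {u : ℝ}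
    (h : u ∈ letterSet e P x a) : updateFn e P x u = a := by
  have h' : (∃ k : ℕ, u ∈ piece e P x k a) ∨ u ∈ pieceInfty e P x a := by
    simpa [letterSet] using h
  have := Classical.epsilon_spec (p := fun a => (∃ k : ℕ, u ∈ piece e P x k a) ∨
    u ∈ pieceInfty e P x a) ⟨a, h'⟩
  refine letterSet_unique (e := e) (P := P) (x := x) (u := u) ?_ h
  simpa [letterSet, updateFn] using this

/-- Outside `[0,1)` no interval contains `u`, and `updateFn` is constant. -/
lemma updateFn_of_notMem [Nonempty A] [Countable A] [MeasurableSingletonClass A] (e : A ↪ ℕ)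
    (P : Kernel (Past A) A) [IsMarkovKernel P] (x : Past A) {u : ℝ} (h : u ∉ Set.Ico (0 : ℝ) 1) :
    updateFn e P x u = Classical.epsilon fun _ : A => False := by
  unfold updateFn
  congr 1
  funext a
  refine eq_false fun h' => h (mem_Ico_of_mem_letterSet (e := e) (P := P) (x := x) (a := a) ?_)
  simpa [letterSet] using h'

lemma pieceLen_congr (P : Kernel (Past A) A) {k : ℕ} {x y : Past A} (h : ∀ i < k, x i = y i)
    (a : A) : pieceLen P x k a = pieceLen P y k a := by
  cases k with
  | zero => rfl
  | succ k =>
    simp only [pieceLen]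
    rw [recent_eq_iff.2 h, recent_eq_iff.2 fun i hi => h i (hi.trans (Nat.lt_succ_self k))]

lemma piece_congr (e : A ↪ ℕ) (P : Kernel (Past A) A) {k : ℕ} {x y : Past A}
    (h : ∀ i < k, x i = y i) (a : A) : piece e P x k a = piece e P y k a := by
  have h1 : pieceLen P x k = pieceLen P y k := funext (pieceLen_congr P h)
  have h2 : ∑ j ∈ Finset.range k, ∑' b, pieceLen P x j b
      = ∑ j ∈ Finset.range k, ∑' b, pieceLen P y j b := by
    refine Finset.sum_congr rfl fun j hj => tsum_congr fun b => pieceLen_congr P (fun i hi => ?_) b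
    exact h i (hi.trans (Finset.mem_range.1 hj))
  rw [piece, piece, h1, h2]

/-- When `u < ωₖ(x)`, the update function looks only at the last `k` symbols of `x`. -/
lemma updateFn_congr [Nonempty A] [Countable A] [MeasurableSingletonClass A] (e : A ↪ ℕ)
    (P : Kernel (Past A) A) [IsMarkovKernel P] {k : ℕ} {x y : Past A} (h : ∀ i < k, x i = y i)
    {u : ℝ} (hu : ENNReal.ofReal u < omegaK P x k) : updateFn e P x u = updateFn e P y u := by
  by_cases h0 : u ∈ Set.Ico (0 : ℝ) 1
  · obtain ⟨j, hj, a, ha⟩ := exists_mem_piece e P x h0.1 hu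
    have hb : u ∈ piece e P y j a := by
      rwa [← piece_congr e P (fun i hi => h i (hi.trans_le hj)) a]
    rw [updateFn_eq (Or.inl (Set.mem_iUnion.2 ⟨j, ha⟩)),
      updateFn_eq (Or.inl (Set.mem_iUnion.2 ⟨j, hb⟩))]
  · rw [updateFn_of_notMem e P x h0, updateFn_of_notMem e P y h0]

lemma piece_zero (e : A ↪ ℕ) (P : Kernel (Past A) A) (x : Past A) (a : A) :
    piece e P x 0 a = slot e 0 (alpha P) a := by
  simp only [piece, Finset.range_zero, Finset.sum_empty]
  rfl

lemma letterOf_eq_some_iff {e : A ↪ ℕ} {P : Kernel (Past A) A} {u : ℝ} {a : A} :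
    letterOf e P u = some a ↔ u ∈ slot e 0 (alpha P) a := by
  classical
  unfold letterOf
  constructor
  · intro h
    split_ifs at h with h'
    have := h'.choose_spec
    rwa [Option.some.inj h] at this
  · intro h
    have h' : ∃ a, u ∈ slot e 0 (alpha P) a := ⟨a, h⟩
    rw [dif_pos h', slot_unique h'.choose_spec h]

lemma updateFn_of_letterOf [Nonempty A] {e : A ↪ ℕ} {P : Kernel (Past A) A} {u : ℝ} {a : A}
    (h : letterOf e P u = some a) (x : Past A) : updateFn e P x u = a := by
  refine updateFn_eq (Or.inl (Set.mem_iUnion.2 ⟨0, ?_⟩))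
  rw [piece_zero]
  exact letterOf_eq_some_iff.1 h

lemma lt_alphaNeg_of_letterOf {e : A ↪ ℕ} {P : Kernel (Past A) A} {u : ℝ} {a : A}
    (h : letterOf e P u = some a) : ENNReal.ofReal u < alphaNeg P := by
  have := slot_lt (letterOf_eq_some_iff.1 h)
  rwa [zero_add] at this

lemma exists_letterOf (e : A ↪ ℕ) (P : Kernel (Past A) A) {u : ℝ} (h0 : 0 ≤ u)
    (h : ENNReal.ofReal u < alphaNeg P) : ∃ a, letterOf e P u = some a := by
  obtain ⟨a, ha⟩ := exists_mem_slot e (base := 0) (ℓ := alpha P) h0 (by simp) (by rwa [zero_add])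
  exact ⟨a, letterOf_eq_some_iff.2 ha⟩

end Update

/-! ### Contexts -/

section Contexts

variable {A : Type*} {τ : Set (Str A)}

lemma context_spec (hτ : IsContextTree τ) (x : Past A) :
    context τ x ∈ τ ∧ IsSuffixOf (context τ x) x :=
  Classical.epsilon_spec (p := fun v => v ∈ τ ∧ IsSuffixOf v x) (hτ.partition x).exists

lemma context_eq (hτ : IsContextTree τ) {x : Past A} {v : Str A} (hv : v ∈ τ)
    (hx : IsSuffixOf v x) : context τ x = v :=
  (hτ.partition x).unique (context_spec hτ x) ⟨hv, hx⟩

lemma exists_context_of_contextLen_le (hτ : IsContextTree τ) {x : Past A} {n : ℕ}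
    (h : contextLen τ x ≤ n) : ∃ v : List A, context τ x = Sum.inl v ∧ Sum.inl v ∈ τ ∧
      v.length ≤ n ∧ recent v.length x = v := by
  obtain ⟨h1, h2⟩ := context_spec hτ x
  unfold contextLen at h
  cases hc : context τ x with
  | inl v =>
    rw [hc] at h h1 h2
    exact ⟨v, rfl, h1, by simpa [strLen] using h, isSuffixOf_inl_iff.1 h2⟩
  | inr y =>
    rw [hc] at h
    simp [strLen] at h

/-- A context of length at most `n` is determined by the last `n` symbols. -/
lemma context_congr (hτ : IsContextTree τ) {x y : Past A} {n : ℕ} (h : contextLen τ x ≤ n)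
    (hxy : ∀ i < n, x i = y i) : context τ y = context τ x := by
  obtain ⟨v, hv, hvτ, hvn, hvx⟩ := exists_context_of_contextLen_le hτ h
  rw [hv]
  refine context_eq hτ hvτ (isSuffixOf_inl_iff.2 ?_)
  rw [← hvx]
  simp only [length_recent]
  exact (recent_eq_iff.2 fun i hi => hxy i (hi.trans_le hvn)).symm

lemma maxContextLen_congr (hτ : IsContextTree τ) {Y Y' : ℤ → Option A} {n : ℤ} {k : ℕ}
    (h : maxContextLen τ Y n ≤ k) (hY : ∀ i : ℕ, i < k → Y (n - i) = Y' (n - i)) :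
    maxContextLen τ Y' n = maxContextLen τ Y n := by
  refine iSup_congr fun a => ?_
  unfold contextLen
  rw [context_congr hτ ((le_iSup (fun a : ℤ → A =>
    contextLen τ (pastUpTo (fun i => (Y i).getD (a i)) n)) a).trans h)]
  intro i hi
  simp only [pastUpTo, hY i hi]

lemma maxContextLen_shift (τ : Set (Str A)) (Y : ℤ → Option A) (m n : ℤ) :
    maxContextLen τ (fun i => Y (i + m)) n = maxContextLen τ Y (n + m) := by
  refine Equiv.iSup_congr (Equiv.arrowCongr (Equiv.addRight m) (Equiv.refl A)) fun a => ?_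
  congr 1
  funext k
  simp [pastUpTo, Equiv.arrowCongr, sub_add_eq_add_sub]

lemma mem_goodTimes_congr (hτ : IsContextTree τ) {Y Y' : ℤ → Option A} {i m : ℤ}
    (hY : ∀ j, i ≤ j → j ≤ m → Y j = Y' j) (h : i ∈ goodTimes τ Y m) : i ∈ goodTimes τ Y' m := by
  refine ⟨h.1, fun j hij hjm => ?_⟩
  rw [← hY j hij hjm]
  refine (h.2 j hij hjm).imp id fun hle => ?_
  rwa [maxContextLen_congr hτ hle fun k hk => hY _ (by omega) (by omega)]

lemma natCast_le_absThetaBar_iff {Y : ℤ → Option A} {n : ℕ} :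
    (n : ℕ∞) ≤ absThetaBar τ Y ↔ ∀ i < n, -(i : ℤ) ∉ goodTimes τ Y 0 := by
  simp only [absThetaBar, le_iInf_iff, Nat.cast_le]
  constructor
  · intro h i hi hmem
    have := h _ hmem
    omega
  · intro h i hi
    by_contra! hlt
    refine h _ hlt ?_
    have := hi.1
    rwa [show -((i.natAbs : ℕ) : ℤ) = i by omega]

lemma absThetaBar_le_iff {Y : ℤ → Option A} {n : ℕ} :
    absThetaBar τ Y ≤ n ↔ ∃ i ≤ n, -(i : ℤ) ∈ goodTimes τ Y 0 := by
  have := natCast_le_absThetaBar_iff (τ := τ) (Y := Y) (n := n + 1)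
  rw [← not_iff_not, not_le]
  push Not
  rw [← ENat.add_one_le_iff (ENat.natCast_ne_top n)]
  simpa [Nat.lt_succ_iff] using this

lemma absThetaBar_eq_iff {Y : ℤ → Option A} {n : ℕ} :
    absThetaBar τ Y = n ↔ -(n : ℤ) ∈ goodTimes τ Y 0 ∧ ∀ i < n, -(i : ℤ) ∉ goodTimes τ Y 0 := by
  rw [le_antisymm_iff, natCast_le_absThetaBar_iff, absThetaBar_le_iff]
  constructor
  · rintro ⟨⟨i, hi, hmem⟩, h⟩
    rcases hi.lt_or_eq with hlt | rfl
    · exact (h i hlt hmem).elim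
    · exact ⟨hmem, h⟩
  · rintro ⟨h1, h2⟩
    exact ⟨⟨n, le_rfl, h1⟩, h2⟩

end Contexts

/-! ### Running an update function -/

section Run

variable {A : Type*}

/-- The sequence `u` seen from time `m`. -/
def shiftBy {B : Type*} (m : ℤ) (u : ℤ → B) : ℤ → B := fun i => u (i + m)

lemma run_add (F : Past A → ℝ → A) (u : ℤ → ℝ) (s : ℤ) (x : Past A) (m n : ℕ) :
    run F u s x (m + n) = run F u (s + m) (run F u s x m) n := by
  induction n with
  | zero => rfl
  | succ n ih =>
    rw [← add_assoc, run, run, ih]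
    push_cast
    rw [add_assoc]

lemma run_shiftBy (F : Past A → ℝ → A) (u : ℤ → ℝ) (m s : ℤ) (x : Past A) (n : ℕ) :
    run F (shiftBy m u) s x n = run F u (s + m) x n := by
  induction n with
  | zero => rfl
  | succ n ih =>
    rw [run, run, ih, shiftBy]
    congr 3
    ring

/-- The symbols of a run are the values of `iterF`. -/
lemma run_apply (F : Past A → ℝ → A) (u : ℤ → ℝ) (s : ℤ) (x : Past A) {n i : ℕ} (h : i < n) :
    run F u s x n i = iterF F u s (s + n - 1 - i) x := by
  induction n generalizing i with
  | zero => omega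
  | succ n ih =>
    cases i with
    | zero =>
      have h1 : s + ((n + 1 : ℕ) : ℤ) - 1 - ((0 : ℕ) : ℤ) = s + n := by push_cast; ring
      rw [h1, run, iterF, add_sub_cancel_left, Int.toNat_natCast, cons]
    | succ i =>
      rw [run, cons, ih (by omega)]
      congr 1
      push_cast
      ring

lemma iterF_eq_run (F : Past A → ℝ → A) (u : ℤ → ℝ) {s t : ℤ} (h : s ≤ t) (x : Past A) :
    iterF F u s t x = run F u s x ((t - s).toNat + 1) 0 := by
  rw [run_apply F u s x (Nat.succ_pos _)]
  congr 1
  push_cast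
  rw [Int.toNat_of_nonneg (by omega)]
  ring

lemma iterF_eq_iterF {F : Past A → ℝ → A} {u : ℤ → ℝ} {s' s t : ℤ} (h : s' ≤ s) (h' : s ≤ t)
    (x : Past A) : iterF F u s' t x = iterF F u s t (run F u s' x (s - s').toNat) := by
  rw [iterF_eq_run F u h', iterF_eq_run F u (h.trans h')]
  conv_rhs => rw [show s = s' + ((s - s').toNat : ℤ) by omega]
  rw [show s' + ((s - s').toNat : ℤ) - s' = s - s' by omega, ← run_add]
  congr 1
  omega

end Run

/-! ### Blocks between good coalescence times -/

section Blocks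

variable {A : Type*} [MeasurableSpace A]

/-- The known letters `Yᵢ`, as a function of `u`. -/
noncomputable def letters (e : A ↪ ℕ) (P : Kernel (Past A) A) (u : ℤ → ℝ) : ℤ → Option A :=
  fun i => letterOf e P (u i)

lemma letters_shiftBy (e : A ↪ ℕ) (P : Kernel (Past A) A) (u : ℤ → ℝ) (m : ℤ) :
    letters e P (shiftBy m u) = fun i => letters e P u (i + m) := rfl

/-- The update at time `j` needs at most `k` symbols in addition to the current context: the letter
is known, or `k ≥ 1` and `u_j` is below `αₖ` at the length of the longest possible context. -/
def Fits (e : A ↪ ℕ) (P : Kernel (Past A) A) (τ : Set (Str A)) (k : ℕ) (u : ℤ → ℝ) (j : ℤ) :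
    Prop :=
  (∃ a, letters e P u j = some a) ∨
    1 ≤ k ∧ ENNReal.ofReal (u j) < alphaLen P τ k (maxContextLen τ (letters e P u) (j - 1))

/-- The block `[θ̄[0], 0]` has length `ℓ + 1`, and each of its updates needs at most `k` symbols
in addition to the current context. -/
def blockSet (e : A ↪ ℕ) (P : Kernel (Past A) A) (τ : Set (Str A)) (k ℓ : ℕ) : Set (ℤ → ℝ) :=
  {u | absThetaBar τ (letters e P u) = ℓ ∧ ∀ j : ℤ, -(ℓ : ℤ) ≤ j → j ≤ 0 → Fits e P τ k u j}

/-- Successive blocks, read backwards from time `0`, have lengths `ℓ + 1` for `ℓ` in the list, and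
each block needs at most as many additional symbols as there are blocks before it. -/
def chainSet (e : A ↪ ℕ) (P : Kernel (Past A) A) (τ : Set (Str A)) : List ℕ → Set (ℤ → ℝ)
  | [] => Set.univ
  | ℓ :: ls => {u | u ∈ blockSet e P τ ls.length ℓ ∧
      shiftBy (-(ℓ + 1)) u ∈ chainSet e P τ ls}

/-- The number of sites covered by blocks of lengths `ℓ + 1`, for `ℓ` in the list. -/
def totalLen (ls : List ℕ) : ℕ := (ls.map (· + 1)).sum

@[simp] lemma totalLen_nil : totalLen [] = 0 := rfl

@[simp] lemma totalLen_cons (ℓ : ℕ) (ls : List ℕ) :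
    totalLen (ℓ :: ls) = ℓ + 1 + totalLen ls := by simp [totalLen]

lemma length_le_totalLen (ls : List ℕ) : ls.length ≤ totalLen ls := by
  induction ls with
  | nil => simp
  | cons ℓ ls ih => simp only [List.length_cons, totalLen_cons]; omega

lemma shiftBy_shiftBy {B : Type*} (m n : ℤ) (u : ℤ → B) :
    shiftBy m (shiftBy n u) = shiftBy (m + n) u := by
  funext i; simp [shiftBy, add_assoc]

lemma shiftBy_zero {B : Type*} (u : ℤ → B) : shiftBy 0 u = u := by
  funext i; simp [shiftBy]

/-- At a time of the block `[-ℓ, 0]`, a past that carries the known letters since the start of the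
block determines its context, so that the update needs only `k` symbols before the block. -/
lemma lt_omegaK_of_mem_blockSet {e : A ↪ ℕ} {P : Kernel (Past A) A} {τ : Set (Str A)}
    (hτ : IsContextTree τ) {k ℓ : ℕ} {u : ℤ → ℝ} (hu : u ∈ blockSet e P τ k ℓ) {n : ℕ}
    (hn : n ≤ ℓ) {p : Past A}
    (hp : ∀ i < n, ∀ a, letters e P u (-ℓ + n - 1 - i) = some a → p i = a) :
    ENNReal.ofReal (u (-ℓ + n)) < omegaK P p (n + k) := by
  obtain ⟨h1, h2⟩ := hu
  have hgood := (absThetaBar_eq_iff.1 h1).1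
  have hknown : (∃ a, letters e P u (-ℓ + n) = some a) →
      ENNReal.ofReal (u (-ℓ + n)) < omegaK P p (n + k) := by
    rintro ⟨a, ha⟩
    refine (lt_alphaNeg_of_letterOf ha).trans_le ?_
    rw [← omegaK_zero P p]
    exact omegaK_mono P p (Nat.zero_le _)
  rcases hgood.2 (-ℓ + n) (by omega) (by omega) with h | hC
  · exact hknown h
  rcases h2 (-ℓ + n) (by omega) (by omega) with h | ⟨hk, hlt⟩
  · exact hknown h
  have hC' : maxContextLen τ (letters e P u) (-ℓ + n - 1) ≤ (n : ℕ∞) := by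
    rwa [show (-(ℓ : ℤ) + n - -(ℓ : ℤ)).toNat = n by omega] at hC
  -- a sequence that completes the known letters and agrees with `p` on the last `n` symbols
  let a : ℤ → A := fun t => p (-ℓ + n - 1 - t).toNat
  have hpa : ∀ i < n, pastUpTo (fun t => (letters e P u t).getD (a t)) (-ℓ + n - 1) i = p i := by
    intro i hi
    simp only [pastUpTo]
    cases hY : letters e P u (-ℓ + n - 1 - i) with
    | some b => simp [hp i hi b hY]
    | none => simp [a]
  have hlen : contextLen τ (pastUpTo (fun t => (letters e P u t).getD (a t)) (-ℓ + n - 1)) ≤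
      maxContextLen τ (letters e P u) (-ℓ + n - 1) :=
    le_iSup (fun a : ℤ → A =>
      contextLen τ (pastUpTo (fun i => (letters e P u i).getD (a i)) (-ℓ + n - 1))) a
  obtain ⟨v, hv, hvτ, hvn, hvx⟩ := exists_context_of_contextLen_le hτ (hlen.trans hC')
  have hvp : recent v.length p = v := by
    conv_rhs => rw [← hvx]
    exact recent_eq_iff.2 fun i hi => (hpa i (hi.trans_le hvn)).symm
  have hvC : (v.length : ℕ∞) ≤ maxContextLen τ (letters e P u) (-ℓ + n - 1) := by
    refine le_trans ?_ hlen
    simp [contextLen, hv, strLen]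
  refine (hlt.trans_le (iInf₂_le_of_le v hvτ (iInf_le _ hvC))).trans_le ?_
  have hω : alphaStr P v k ≤ omegaK P p (v.length + k) := by
    refine (iInf₂_le (recent k fun i => p (v.length + i)) (length_recent _ _)).trans (le_of_eq ?_)
    rw [omegaK, recent_add, hvp]
  exact hω.trans (omegaK_mono P p (by omega))

variable [Nonempty A]

lemma run_of_letters {e : A ↪ ℕ} {P : Kernel (Past A) A} (u : ℤ → ℝ) (s : ℤ) (x : Past A) {n : ℕ}
    {i : ℕ} (hi : i < n) {a : A} (ha : letters e P u (s + n - 1 - i) = some a) :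
    run (updateFn e P) u s x n i = a := by
  rw [run_apply _ _ _ _ hi, iterF]
  exact updateFn_of_letterOf ha _

variable [Countable A] [MeasurableSingletonClass A]

/-- Over a block, two runs that start from pasts with the same last `k` symbols stay equal. -/
lemma run_congr_of_mem_blockSet {e : A ↪ ℕ} {P : Kernel (Past A) A} [IsMarkovKernel P]
    {τ : Set (Str A)} (hτ : IsContextTree τ) {k ℓ : ℕ} {u : ℤ → ℝ}
    (hu : u ∈ blockSet e P τ k ℓ) {K : ℕ} (hK : k ≤ K) {w w' : Past A}
    (hw : ∀ i < K, w i = w' i) {n : ℕ} (hn : n ≤ ℓ + 1) :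
    ∀ i < K + n, run (updateFn e P) u (-ℓ) w n i = run (updateFn e P) u (-ℓ) w' n i := by
  induction n with
  | zero => simpa [run] using hw
  | succ n ih =>
    have ih := ih (by omega)
    intro i hi
    cases i with
    | succ i => exact ih i (by omega)
    | zero =>
      refine updateFn_congr e P (k := n + k) (fun i hi => ih i (by omega)) ?_
      exact lt_omegaK_of_mem_blockSet hτ hu (by omega) fun i hi a ha => run_of_letters u _ w hi ha

/-- On `chainSet`, the run over the blocks forgets the past it starts from. -/
lemma run_congr_of_mem_chainSet {e : A ↪ ℕ} {P : Kernel (Past A) A} [IsMarkovKernel P]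
    {τ : Set (Str A)} (hτ : IsContextTree τ) (ls : List ℕ) {u : ℤ → ℝ}
    (hu : u ∈ chainSet e P τ ls) (w w' : Past A) :
    ∀ i < totalLen ls, run (updateFn e P) u (1 - totalLen ls) w (totalLen ls) i =
      run (updateFn e P) u (1 - totalLen ls) w' (totalLen ls) i := by
  induction ls generalizing u w w' with
  | nil => simp
  | cons ℓ ls ih =>
    have ih := ih hu.2 w w'
    have hs : (1 : ℤ) - totalLen (ℓ :: ls) + totalLen ls = -ℓ := by
      rw [totalLen_cons]; push_cast; ring
    have hs' : (1 : ℤ) - totalLen ls + -((ℓ : ℤ) + 1) = 1 - totalLen (ℓ :: ls) := by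
      rw [totalLen_cons]; push_cast; ring
    simp only [run_shiftBy, hs'] at ih
    have hlen : totalLen (ℓ :: ls) = totalLen ls + (ℓ + 1) := by rw [totalLen_cons]; omega
    have key := run_congr_of_mem_blockSet hτ hu.1 (length_le_totalLen ls) ih le_rfl
    simp only [← hs, ← run_add] at key
    rw [← hlen] at key
    exact key

end Blocks

section ChainCombinatorics

variable {A : Type*} [MeasurableSpace A] {e : A ↪ ℕ} {P : Kernel (Past A) A} {τ : Set (Str A)}

lemma shiftBy_mem_chainSet_of_append (ls r : List ℕ) {u : ℤ → ℝ}
    (h : u ∈ chainSet e P τ (ls ++ r)) : shiftBy (-(totalLen ls : ℤ)) u ∈ chainSet e P τ r := by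
  induction ls generalizing u with
  | nil => simpa [shiftBy_zero] using h
  | cons ℓ ls ih =>
    have := ih h.2
    rw [shiftBy_shiftBy] at this
    rw [totalLen_cons]
    convert this using 2
    push_cast
    ring

/-- The lengths of the successive blocks are functions of `u`. -/
lemma prefix_or_prefix_of_mem_chainSet (ls ls' : List ℕ) {u : ℤ → ℝ}
    (h : u ∈ chainSet e P τ ls) (h' : u ∈ chainSet e P τ ls') : ls <+: ls' ∨ ls' <+: ls := by
  induction ls generalizing u ls' with
  | nil => exact Or.inl List.nil_prefix
  | cons ℓ ls ih =>
    cases ls' with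
    | nil => exact Or.inr List.nil_prefix
    | cons ℓ' ls' =>
      obtain rfl : ℓ = ℓ' := by exact_mod_cast h.1.1.symm.trans h'.1.1
      simpa [List.cons_prefix_cons] using ih ls' h.2 h'.2

variable (e P τ) in
/-- The event that some chain of blocks that ends at time `0` forgets the past. -/
def renewalSet : Set (ℤ → ℝ) := {u | ∃ ℓ ls, u ∈ chainSet e P τ (ℓ :: ls)}

/-- The decomposition according to the last (that is, earliest in time) renewal. -/
lemma pairwise_disjoint_lastRenewal :
    Pairwise (Function.onFun Disjoint fun ls : List ℕ => chainSet e P τ ls ∩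
      shiftBy (-(totalLen ls : ℤ)) ⁻¹' (renewalSet e P τ)ᶜ) := by
  have key : ∀ (ls ls' : List ℕ) (u : ℤ → ℝ), ls ≠ ls' → ls <+: ls' → u ∈ chainSet e P τ ls' →
      shiftBy (-(totalLen ls : ℤ)) u ∈ renewalSet e P τ := by
    rintro ls _ u hne ⟨r, rfl⟩ hu
    cases r with
    | nil => simp at hne
    | cons ℓ r => exact ⟨ℓ, r, shiftBy_mem_chainSet_of_append _ _ hu⟩
  intro ls ls' hne
  refine Set.disjoint_left.2 fun u hu hu' => ?_
  rcases prefix_or_prefix_of_mem_chainSet ls ls' hu.1 hu'.1 with h | h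
  · exact hu.2 (key ls ls' u hne h hu'.1)
  · exact hu'.2 (key ls' ls u hne.symm h hu.1)

end ChainCombinatorics

/-! ### The law of the driving sequence -/

section Driving

/-- The uniform law on `[0,1)`. -/
noncomputable def uniformLaw : Measure ℝ := volume.restrict (Set.Ico (0 : ℝ) 1)

instance : IsProbabilityMeasure uniformLaw := ⟨by simp [uniformLaw]⟩

instance : NullSingletonClass uniformLaw := by unfold uniformLaw; infer_instance

/-- The law of an i.i.d. sequence of uniform variables on `[0,1)`. -/
noncomputable def drivingLaw : Measure (ℤ → ℝ) := Measure.infinitePi fun _ => uniformLaw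

instance : IsProbabilityMeasure drivingLaw := by unfold drivingLaw; infer_instance

lemma drivingLaw_map_eval (i : ℤ) : drivingLaw.map (fun u => u i) = uniformLaw :=
  Measure.infinitePi_map_eval _ i

lemma measurable_shiftBy {B : Type*} [MeasurableSpace B] (m : ℤ) :
    Measurable (shiftBy m : (ℤ → B) → ℤ → B) :=
  measurable_pi_iff.2 fun i => measurable_pi_apply (i + m)

lemma measurePreserving_shiftBy (m : ℤ) :
    MeasurePreserving (shiftBy m) drivingLaw drivingLaw :=
  ⟨measurable_shiftBy m,
    Measure.map_infinitePi_infinitePi_of_inj (P := fun _ : ℤ => uniformLaw)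
      (f := fun i : ℤ => i + m) (add_left_injective m)⟩

lemma measurable_iSup_comap_of_dependsOn {β : Type*} [MeasurableSpace β] {f : (ℤ → ℝ) → β}
    (hf : Measurable f) {S : Set ℤ} (hS : DependsOn f S) :
    Measurable[⨆ i ∈ S, MeasurableSpace.comap (fun u : ℤ → ℝ => u i) inferInstance] f := by
  classical
  have hfac : f = f ∘ fun u i => if i ∈ S then u i else 0 := by
    funext u
    exact hS fun i hi => by simp [hi]
  rw [hfac]
  refine hf.comp ?_
  refine @measurable_pi_lambda _ _ _ (_) _ _ fun i => ?_
  by_cases hi : i ∈ S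
  · simp only [hi, if_true]
    exact (comap_measurable (fun u : ℤ → ℝ => u i)).mono
      (le_iSup₂_of_le (f := fun i (_ : i ∈ S) =>
        MeasurableSpace.comap (fun u : ℤ → ℝ => u i) inferInstance) i hi le_rfl) le_rfl
  · simp only [hi, if_false]
    exact measurable_const

/-- Functions of disjoint sets of coordinates are independent. -/
lemma indepFun_of_dependsOn {β γ : Type*} [MeasurableSpace β] [MeasurableSpace γ]
    {f : (ℤ → ℝ) → β} {g : (ℤ → ℝ) → γ} (hf : Measurable f) (hg : Measurable g) {S T : Set ℤ}
    (hS : DependsOn f S) (hT : DependsOn g T) (hST : Disjoint S T) :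
    IndepFun f g drivingLaw := by
  have hind : iIndep (fun i : ℤ => MeasurableSpace.comap (fun u : ℤ → ℝ => u i) inferInstance)
      drivingLaw :=
    iIndepFun_infinitePi (P := fun _ : ℤ => uniformLaw) (X := fun _ x => x) fun _ => measurable_id
  have h := indep_iSup_of_disjoint (fun i => (measurable_pi_apply i).comap_le) hind hST
  exact indep_of_indep_of_le_right
    (indep_of_indep_of_le_left h (measurable_iSup_comap_of_dependsOn hf hS).comap_le)
    (measurable_iSup_comap_of_dependsOn hg hT).comap_le

lemma drivingLaw_inter {B B' : Set (ℤ → ℝ)} (hB : MeasurableSet B) (hB' : MeasurableSet B')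
    {S T : Set ℤ} (hS : ∀ u u' : ℤ → ℝ, (∀ i ∈ S, u i = u' i) → u ∈ B → u' ∈ B)
    (hT : ∀ u u' : ℤ → ℝ, (∀ i ∈ T, u i = u' i) → u ∈ B' → u' ∈ B') (hST : Disjoint S T) :
    drivingLaw (B ∩ B') = drivingLaw B * drivingLaw B' := by
  have h := indepFun_of_dependsOn (f := fun u => u ∈ B) (g := fun u => u ∈ B')
    (measurableSet_setOfPred.1 hB) (measurableSet_setOfPred.1 hB') (S := S) (T := T)
    (fun u u' h => propext ⟨hS u u' h, hS u' u fun i hi => (h i hi).symm⟩)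
    (fun u u' h => propext ⟨hT u u' h, hT u' u fun i hi => (h i hi).symm⟩) hST
  have := h.measure_inter_preimage_eq_mul {True} {True} (measurableSet_singleton _)
    (measurableSet_singleton _)
  simpa [Set.preimage] using this

end Driving

/-! ### Measurability and locality of the block events -/

section BlockEvents

lemma measurableSet_slot {A : Type*} (e : A ↪ ℕ) (base : ℝ≥0∞) (ℓ : A → ℝ≥0∞) (a : A) :
    MeasurableSet (slot e base ℓ a) :=
  measurableSet_Ici.inter (ENNReal.measurable_ofReal measurableSet_Ico)

section Locality

variable {A : Type*} {τ : Set (Str A)}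

lemma maxContextLen_congr_of_forall {Y Y' : ℤ → Option A} {n : ℤ} (h : ∀ i ≤ n, Y i = Y' i) :
    maxContextLen τ Y n = maxContextLen τ Y' n := by
  refine iSup_congr fun a => ?_
  congr 1
  funext k
  simp only [pastUpTo]
  rw [h _ (by omega)]

lemma natCast_le_absThetaBar_congr (hτ : IsContextTree τ) {Y Y' : ℤ → Option A} {n : ℕ}
    (h : ∀ i : ℤ, -(n : ℤ) < i → i ≤ 0 → Y i = Y' i) (hn : (n : ℕ∞) ≤ absThetaBar τ Y) :
    (n : ℕ∞) ≤ absThetaBar τ Y' := by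
  rw [natCast_le_absThetaBar_iff] at hn ⊢
  intro i hi hmem
  exact hn i hi (mem_goodTimes_congr hτ (fun j hj hj0 => (h j (by omega) hj0).symm) hmem)

lemma absThetaBar_congr (hτ : IsContextTree τ) {Y Y' : ℤ → Option A} {n : ℕ}
    (h : ∀ i : ℤ, -(n : ℤ) ≤ i → i ≤ 0 → Y i = Y' i) (hn : absThetaBar τ Y = n) :
    absThetaBar τ Y' = n := by
  rw [absThetaBar_eq_iff] at hn ⊢
  refine ⟨mem_goodTimes_congr hτ h hn.1, fun i hi hmem => hn.2 i hi ?_⟩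
  exact mem_goodTimes_congr hτ (fun j hj hj0 => (h j (by omega) hj0).symm) hmem

end Locality

variable {A : Type*} [MeasurableSpace A]

lemma measurableSet_letterOf [Countable A] (e : A ↪ ℕ) (P : Kernel (Past A) A) (o : Option A) :
    MeasurableSet {x : ℝ | letterOf e P x = o} := by
  cases o with
  | some a =>
    simp only [letterOf_eq_some_iff]
    exact measurableSet_slot e 0 (alpha P) a
  | none =>
    have : {x : ℝ | letterOf e P x = none} = (⋃ a, slot e 0 (alpha P) a)ᶜ := by
      ext x
      simp [Option.eq_none_iff_forall_ne_some, letterOf_eq_some_iff]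
    rw [this]
    exact (MeasurableSet.iUnion fun a => measurableSet_slot e 0 (alpha P) a).compl

/-- An event that is determined by finitely many of the known letters is measurable. -/
lemma measurableSet_of_letters [Countable A] (e : A ↪ ℕ) (P : Kernel (Past A) A) {n : ℕ}
    (t : Fin n → ℤ) {B : Set (ℤ → ℝ)}
    (hB : ∀ u u', (∀ i, letters e P u (t i) = letters e P u' (t i)) → u ∈ B → u' ∈ B) :
    MeasurableSet B := by
  have : B = ⋃ (y : Fin n → Option A) (_ : ∃ u ∈ B, (fun i => letters e P u (t i)) = y),
      ⋂ i, (fun u : ℤ → ℝ => u (t i)) ⁻¹' {x | letterOf e P x = y i} := by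
    ext u
    simp only [Set.mem_iUnion, Set.mem_iInter, Set.mem_preimage, Set.mem_ofPred_eq, exists_prop]
    constructor
    · intro hu
      exact ⟨fun i => letters e P u (t i), ⟨u, hu, rfl⟩, fun _ => rfl⟩
    · rintro ⟨y, ⟨u', hu', rfl⟩, h⟩
      exact hB u' u (fun i => (h i).symm) hu'
  rw [this]
  exact .iUnion fun y => .iUnion fun _ => .iInter fun i =>
    measurable_pi_apply (t i) (measurableSet_letterOf e P (y i))

variable {e : A ↪ ℕ} {P : Kernel (Past A) A} {τ : Set (Str A)}

lemma letters_congr {u u' : ℤ → ℝ} {i : ℤ} (h : u i = u' i) :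
    letters e P u i = letters e P u' i := by simp [letters, h]

lemma measurable_maxContextLen [Countable A] (e : A ↪ ℕ) (P : Kernel (Past A) A)
    (hτ : IsContextTree τ) (n : ℤ) :
    Measurable fun u : ℤ → ℝ => maxContextLen τ (letters e P u) n := by
  refine ENat.measurable_iff.2 fun k => ?_
  refine measurableSet_of_letters e P (fun i : Fin k => n - (i : ℕ)) fun u u' h hu => ?_
  simp only [Set.mem_preimage, Set.mem_singleton_iff] at hu ⊢
  rw [maxContextLen_congr hτ hu.le fun i hi => h ⟨i, hi⟩, hu]

lemma measurable_absThetaBar [Countable A] (e : A ↪ ℕ) (P : Kernel (Past A) A)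
    (hτ : IsContextTree τ) : Measurable fun u : ℤ → ℝ => absThetaBar τ (letters e P u) := by
  refine ENat.measurable_iff.2 fun k => ?_
  refine measurableSet_of_letters e P (fun i : Fin (k + 1) => -((i : ℕ) : ℤ)) fun u u' h hu => ?_
  refine absThetaBar_congr hτ (fun i hi hi0 => ?_) hu
  have := h ⟨i.natAbs, by omega⟩
  simpa [show -|i| = i by rw [abs_of_nonpos hi0, neg_neg]] using this

lemma measurableSet_blockSet [Countable A] (e : A ↪ ℕ) (P : Kernel (Past A) A)
    (hτ : IsContextTree τ) (k ℓ : ℕ) : MeasurableSet (blockSet e P τ k ℓ) := by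
  have : blockSet e P τ k ℓ = {u | absThetaBar τ (letters e P u) = ℓ} ∩
      ⋂ (j : ℤ) (_ : -(ℓ : ℤ) ≤ j) (_ : j ≤ 0), ({u | ∃ a, letters e P u j = some a} ∪
        ({_u | 1 ≤ k} ∩ {u | ENNReal.ofReal (u j) <
          alphaLen P τ k (maxContextLen τ (letters e P u) (j - 1))})) := by
    ext u
    simp [blockSet, Fits]
  rw [this]
  refine (measurable_absThetaBar e P hτ (measurableSet_singleton _)).inter
    (.iInter fun j => .iInter fun _ => .iInter fun _ => .union ?_ (.inter (.const _) ?_))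
  · exact measurableSet_of_letters e P (fun _ : Fin 1 => j) fun u u' h hu => by
      simpa [← h 0] using hu
  · exact measurableSet_lt (ENNReal.measurable_ofReal.comp (measurable_pi_apply j))
      ((measurable_from_top (f := alphaLen P τ k)).comp (measurable_maxContextLen e P hτ (j - 1)))

lemma mem_blockSet_congr (hτ : IsContextTree τ) {k ℓ : ℕ} {u u' : ℤ → ℝ}
    (h : ∀ i ∈ Set.Icc (-(ℓ : ℤ)) 0, u i = u' i) (hu : u ∈ blockSet e P τ k ℓ) :
    u' ∈ blockSet e P τ k ℓ := by
  have hY : ∀ i : ℤ, -(ℓ : ℤ) ≤ i → i ≤ 0 → letters e P u i = letters e P u' i :=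
    fun i hi hi0 => letters_congr (h i ⟨hi, hi0⟩)
  refine ⟨absThetaBar_congr hτ hY hu.1, fun j hj hj0 => ?_⟩
  have hgood := (absThetaBar_eq_iff.1 hu.1).1
  rcases hgood.2 j hj hj0 with hk | hC
  · rw [hY j hj hj0] at hk
    exact Or.inl hk
  · refine (hu.2 j hj hj0).imp (fun hk => by rwa [hY j hj hj0] at hk) fun hk => ⟨hk.1, ?_⟩
    rw [maxContextLen_congr hτ hC fun i hi => hY _ (by omega) (by omega), ← h j ⟨hj, hj0⟩]
    exact hk.2

lemma measurableSet_chainSet [Countable A] (e : A ↪ ℕ) (P : Kernel (Past A) A)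
    (hτ : IsContextTree τ) (ls : List ℕ) : MeasurableSet (chainSet e P τ ls) := by
  induction ls with
  | nil => exact .univ
  | cons ℓ ls ih => exact (measurableSet_blockSet e P hτ _ ℓ).inter (measurable_shiftBy _ ih)

lemma mem_chainSet_congr (hτ : IsContextTree τ) (ls : List ℕ) {u u' : ℤ → ℝ}
    (h : ∀ i ∈ Set.Ioc (-(totalLen ls : ℤ)) 0, u i = u' i) (hu : u ∈ chainSet e P τ ls) :
    u' ∈ chainSet e P τ ls := by
  induction ls generalizing u u' with
  | nil => trivial
  | cons ℓ ls ih =>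
    rw [totalLen_cons] at h
    push_cast at h
    refine ⟨mem_blockSet_congr hτ (fun i hi => h i ⟨by have := hi.1; omega, hi.2⟩) hu.1,
      ih (fun i hi => ?_) hu.2⟩
    exact h _ ⟨by have := hi.1; omega, by have := hi.2; omega⟩

lemma measurableSet_renewalSet [Countable A] (e : A ↪ ℕ) (P : Kernel (Past A) A)
    (hτ : IsContextTree τ) : MeasurableSet (renewalSet e P τ) := by
  have : renewalSet e P τ = ⋃ ℓ, ⋃ ls, chainSet e P τ (ℓ :: ls) := by
    ext u; simp [renewalSet]
  rw [this]
  exact .iUnion fun ℓ => .iUnion fun ls => measurableSet_chainSet e P hτ _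

lemma mem_renewalSet_congr (hτ : IsContextTree τ) {u u' : ℤ → ℝ}
    (h : ∀ i ≤ 0, u i = u' i) (hu : u ∈ renewalSet e P τ) : u' ∈ renewalSet e P τ := by
  obtain ⟨ℓ, ls, hu⟩ := hu
  exact ⟨ℓ, ls, mem_chainSet_congr hτ _ (fun i hi => h i hi.2) hu⟩

lemma drivingLaw_inter_shiftBy {B B' : Set (ℤ → ℝ)} (hB : MeasurableSet B)
    (hB' : MeasurableSet B') {n : ℕ}
    (hS : ∀ u u' : ℤ → ℝ, (∀ i ∈ Set.Ioc (-(n : ℤ)) 0, u i = u' i) → u ∈ B → u' ∈ B)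
    (hT : ∀ u u' : ℤ → ℝ, (∀ i ≤ 0, u i = u' i) → u ∈ B' → u' ∈ B') :
    drivingLaw (B ∩ shiftBy (-(n : ℤ)) ⁻¹' B') = drivingLaw B * drivingLaw B' := by
  rw [drivingLaw_inter hB (measurable_shiftBy _ hB') (T := Set.Iic (-(n : ℤ))) hS ?_ ?_,
    (measurePreserving_shiftBy _).measure_preimage hB'.nullMeasurableSet]
  · intro u u' h hu
    exact hT _ _ (fun i hi => h _ (by simp only [Set.mem_Iic]; omega)) hu
  · refine Set.disjoint_left.2 fun i hi hi' => ?_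
    exact absurd hi.1 (not_lt.2 hi')

end BlockEvents

/-! ### Renewals of the backward chain of blocks -/

section Renewal

variable {A : Type*} [MeasurableSpace A] [Countable A] {e : A ↪ ℕ} {P : Kernel (Past A) A}
  {τ : Set (Str A)}

lemma drivingLaw_chainSet_cons (hτ : IsContextTree τ) (ℓ : ℕ) (ls : List ℕ) :
    drivingLaw (chainSet e P τ (ℓ :: ls)) =
      drivingLaw (blockSet e P τ ls.length ℓ) * drivingLaw (chainSet e P τ ls) := by
  have := drivingLaw_inter_shiftBy (n := ℓ + 1) (measurableSet_blockSet e P hτ ls.length ℓ)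
    (measurableSet_chainSet e P hτ ls)
    (fun u u' h hu => mem_blockSet_congr hτ
      (fun i hi => h i ⟨by have := hi.1; push_cast; omega, hi.2⟩) hu)
    (fun u u' h hu => mem_chainSet_congr hτ ls (fun i hi => h i hi.2) hu)
  rw [← this]
  push_cast
  rfl

/-- The expected number of renewals at the start of the `n`-th block. -/
lemma prod_le_tsum_chainSet (hτ : IsContextTree τ) {a : ℕ → ℝ≥0∞}
    (ha : ∀ k, a k ≤ ∑' ℓ, drivingLaw (blockSet e P τ k ℓ)) (n : ℕ) :
    ∏ j ∈ Finset.range n, a j ≤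
      ∑' ls : List ℕ, if ls.length = n then drivingLaw (chainSet e P τ ls) else 0 := by
  induction n with
  | zero =>
    refine le_trans ?_ (ENNReal.le_tsum ([] : List ℕ))
    simp [chainSet]
  | succ n ih =>
    have hinj : Function.Injective fun q : ℕ × List ℕ => q.1 :: q.2 := by
      rintro ⟨a, l⟩ ⟨b, l'⟩ h
      simpa using h
    calc ∏ j ∈ Finset.range (n + 1), a j
        ≤ (∑' ls : List ℕ, if ls.length = n then drivingLaw (chainSet e P τ ls) else 0) *
            ∑' ℓ, drivingLaw (blockSet e P τ n ℓ) := by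
          rw [Finset.prod_range_succ]
          exact mul_le_mul' ih (ha n)
      _ = ∑' q : ℕ × List ℕ, if (q.1 :: q.2).length = n + 1 then
            drivingLaw (chainSet e P τ (q.1 :: q.2)) else 0 := by
          rw [ENNReal.tsum_prod', mul_comm, ← ENNReal.tsum_mul_right]
          refine tsum_congr fun ℓ => ?_
          rw [← ENNReal.tsum_mul_left]
          refine tsum_congr fun ls => ?_
          by_cases h : ls.length = n
          · simp [h, drivingLaw_chainSet_cons hτ]
          · simp [h]
      _ ≤ _ := ENNReal.tsum_comp_le_tsum_of_injective hinj fun ls : List ℕ =>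
          if ls.length = n + 1 then drivingLaw (chainSet e P τ ls) else 0

/-- If the expected number of renewals is infinite, then a renewal occurs almost surely: the
last renewals form disjoint events, of total probability the expected number of
renewals times the probability that there is no renewal. -/
lemma drivingLaw_compl_renewalSet (hτ : IsContextTree τ) {a : ℕ → ℝ≥0∞}
    (ha : ∀ k, a k ≤ ∑' ℓ, drivingLaw (blockSet e P τ k ℓ))
    (hsum : ∑' k : ℕ, ∏ j ∈ Finset.range (k + 1), a j = ⊤) :
    drivingLaw (renewalSet e P τ)ᶜ = 0 := by
  have hG := measurableSet_renewalSet e P hτ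
  have htot : ∑' ls : List ℕ, drivingLaw (chainSet e P τ ls) = ⊤ := by
    rw [eq_top_iff, ← hsum]
    calc ∑' k : ℕ, ∏ j ∈ Finset.range (k + 1), a j
        ≤ ∑' k : ℕ, ∑' ls : List ℕ,
            if ls.length = k + 1 then drivingLaw (chainSet e P τ ls) else 0 :=
          ENNReal.tsum_le_tsum fun k => prod_le_tsum_chainSet hτ ha (k + 1)
      _ = ∑' ls : List ℕ, ∑' k : ℕ,
            if ls.length = k + 1 then drivingLaw (chainSet e P τ ls) else 0 := ENNReal.tsum_comm
      _ ≤ _ := ENNReal.tsum_le_tsum fun ls => by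
          refine (ENNReal.tsum_le_tsum (g := fun k => if k = ls.length - 1 then
            drivingLaw (chainSet e P τ ls) else 0) fun k => ?_).trans
            (tsum_ite_eq (ls.length - 1) fun _ => drivingLaw (chainSet e P τ ls)).le
          split_ifs <;> first | exact le_rfl | exact zero_le | omega
  have hle : ∑' ls : List ℕ, drivingLaw (chainSet e P τ ls ∩
      shiftBy (-(totalLen ls : ℤ)) ⁻¹' (renewalSet e P τ)ᶜ) ≤ 1 := by
    rw [← measure_iUnion pairwise_disjoint_lastRenewal fun ls =>
      (measurableSet_chainSet e P hτ ls).inter (measurable_shiftBy _ hG.compl)]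
    exact prob_le_one
  have heq : ∀ ls : List ℕ, drivingLaw (chainSet e P τ ls ∩
      shiftBy (-(totalLen ls : ℤ)) ⁻¹' (renewalSet e P τ)ᶜ) =
      drivingLaw (chainSet e P τ ls) * drivingLaw (renewalSet e P τ)ᶜ := fun ls =>
    drivingLaw_inter_shiftBy (measurableSet_chainSet e P hτ ls) hG.compl
      (fun u u' h hu => mem_chainSet_congr hτ ls h hu)
      (fun u u' h hu hu' => hu (mem_renewalSet_congr hτ (fun i hi => (h i hi).symm) hu'))
  simp_rw [heq] at hle
  rw [ENNReal.tsum_mul_right, htot] at hle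
  by_contra h
  rw [ENNReal.top_mul h] at hle
  exact absurd hle (by simp)

end Renewal

/-! ### The probability that a block needs at most `k` more symbols -/

section Wald

variable {A : Type*} [MeasurableSpace A]

/-- The uniform variables almost surely avoid the countably many thresholds `αₖⁱ`. -/
lemma ae_ofReal_ne_alphaLen (P : Kernel (Past A) A) (τ : Set (Str A)) (k : ℕ) :
    ∀ᵐ u ∂drivingLaw, ∀ i : ℕ∞, ENNReal.ofReal (u 0) ≠ alphaLen P τ k i := by
  rw [ae_all_iff]
  intro i
  have h0 : ∀ᵐ x ∂uniformLaw, ENNReal.ofReal x ≠ alphaLen P τ k i := by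
    have h1 : ∀ᵐ x ∂uniformLaw, x ∈ Set.Ico (0 : ℝ) 1 :=
      ae_restrict_mem measurableSet_Ico
    have h2 : ∀ᵐ x ∂uniformLaw, x ≠ (alphaLen P τ k i).toReal :=
      compl_mem_ae_iff.2 (measure_singleton _)
    filter_upwards [h1, h2] with x hx hx' h
    exact hx' (by rw [← h, ENNReal.toReal_ofReal hx.1])
  rw [← drivingLaw_map_eval 0] at h0
  exact ae_of_ae_map (measurable_pi_apply 0).aemeasurable h0

variable [Countable A] {e : A ↪ ℕ} {P : Kernel (Past A) A}
  {τ : Set (Str A)}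

lemma tsum_blockSet (hτ : IsContextTree τ) (k : ℕ) :
    ∑' ℓ, drivingLaw (blockSet e P τ k ℓ) = drivingLaw (⋃ ℓ, blockSet e P τ k ℓ) := by
  refine (measure_iUnion ?_ fun ℓ => measurableSet_blockSet e P hτ k ℓ).symm
  intro ℓ ℓ' hne
  refine Set.disjoint_left.2 fun u hu hu' => hne ?_
  exact_mod_cast hu.1.symm.trans hu'.1

lemma alphaNeg_le_one [Nonempty A] [MeasurableSingletonClass A] (P : Kernel (Past A) A)
    [IsMarkovKernel P] : alphaNeg P ≤ 1 :=
  omegaK_le_one P (fun _ => Classical.arbitrary A) 0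

/-- If the letter at time `0` is known, then the block is reduced to the time `0`. -/
lemma alphaNeg_le_tsum_blockSet [Nonempty A] [MeasurableSingletonClass A] [IsMarkovKernel P]
    (k : ℕ) : alphaNeg P ≤ ∑' ℓ, drivingLaw (blockSet e P τ k ℓ) := by
  have hα := alphaNeg_le_one P
  have hα' : alphaNeg P ≠ ⊤ := ne_top_of_le_ne_top ENNReal.one_ne_top hα
  have hsub : (fun u : ℤ → ℝ => u 0) ⁻¹' Set.Ico 0 (alphaNeg P).toReal ⊆
      blockSet e P τ k 0 := by
    intro u hu
    have hY : ∃ a, letters e P u 0 = some a :=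
      exists_letterOf e P hu.1 ((ENNReal.ofReal_lt_iff_lt_toReal hu.1 hα').2 hu.2)
    refine ⟨?_, fun j hj hj0 => ?_⟩
    · rw [absThetaBar_eq_iff]
      refine ⟨⟨by simp, fun j hj hj0 => ?_⟩, by simp⟩
      obtain rfl : j = 0 := by simp at hj; omega
      exact Or.inl hY
    · obtain rfl : j = 0 := by simp at hj; omega
      exact Or.inl hY
  have hval : drivingLaw ((fun u : ℤ → ℝ => u 0) ⁻¹' Set.Ico 0 (alphaNeg P).toReal) =
      alphaNeg P := by
    rw [← Measure.map_apply (measurable_pi_apply 0) measurableSet_Ico, drivingLaw_map_eval,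
      uniformLaw, Measure.restrict_apply measurableSet_Ico, Set.Ico_inter_Ico]
    have : (alphaNeg P).toReal ≤ 1 := ENNReal.toReal_le_of_le_ofReal zero_le_one (by simpa)
    simp [this, hα']
  calc alphaNeg P ≤ drivingLaw (blockSet e P τ k 0) := hval.symm.le.trans (measure_mono hsub)
    _ ≤ _ := ENNReal.le_tsum 0

lemma tsum_indicator_le (N : ℕ∞) :
    ∑' n : ℕ, (if (n : ℕ∞) ≤ N then (1 : ℝ≥0∞) else 0) ≤ (N : ℝ≥0∞) + 1 := by
  induction N using ENat.recTopCoe with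
  | top => simp
  | coe m =>
    rw [tsum_eq_sum (s := Finset.range (m + 1)) fun n hn => ?_]
    · refine (Finset.sum_le_sum (g := fun _ => 1) fun n _ => ?_).trans (by simp)
      split_ifs <;> simp
    · rw [if_neg]
      simp only [Finset.mem_range] at hn
      simp only [Nat.cast_le]
      omega

/-- The expected length of a block, as the sum of the probabilities that it is longer than `n`. -/
lemma tsum_le_absThetaBar (e : A ↪ ℕ) (P : Kernel (Past A) A) (hτ : IsContextTree τ) :
    ∑' n : ℕ, drivingLaw {u | (n : ℕ∞) ≤ absThetaBar τ (letters e P u)} ≤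
      ∫⁻ u, (absThetaBar τ (letters e P u) : ℝ≥0∞) ∂drivingLaw + 1 := by
  have hN := measurable_absThetaBar e P hτ
  have hm : ∀ n : ℕ, MeasurableSet {u | (n : ℕ∞) ≤ absThetaBar τ (letters e P u)} := fun n =>
    hN (.of_discrete (s := Set.Ici (n : ℕ∞)))
  calc ∑' n : ℕ, drivingLaw {u | (n : ℕ∞) ≤ absThetaBar τ (letters e P u)}
      = ∑' n : ℕ, ∫⁻ u, {u | (n : ℕ∞) ≤ absThetaBar τ (letters e P u)}.indicator 1 u
          ∂drivingLaw := by
        simp_rw [lintegral_indicator_one (hm _)]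
    _ = ∫⁻ u, ∑' n : ℕ, {u | (n : ℕ∞) ≤ absThetaBar τ (letters e P u)}.indicator 1 u
          ∂drivingLaw :=
        (lintegral_tsum fun n => (measurable_one.indicator (hm n)).aemeasurable).symm
    _ ≤ ∫⁻ u, ((absThetaBar τ (letters e P u) : ℝ≥0∞) + 1) ∂drivingLaw := by
        refine lintegral_mono fun u => ?_
        simpa [Set.indicator_apply] using tsum_indicator_le (absThetaBar τ (letters e P u))
    _ = _ := by rw [lintegral_add_right _ measurable_const]; simp

/-- Wald's identity in disguise. The block reaches back to time `-n` according to what happens at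
the times after `-n`, and the update at time `-n` fits according to what happens up to
time `-n`; so the expected number of misfits in a block is at most the product of the expected
length of a block with the probability of a misfit. -/
lemma one_sub_le_tsum_blockSet (hτ : IsContextTree τ) {k : ℕ} (hk : 1 ≤ k)
    (hfin : ∫⁻ u, (absThetaBar τ (letters e P u) : ℝ≥0∞) ∂drivingLaw < ⊤) :
    1 - (∫⁻ u, (absThetaBar τ (letters e P u) : ℝ≥0∞) ∂drivingLaw + 1) *
        drivingLaw {u | alphaLen P τ k (maxContextLen τ (letters e P u) (-1)) <
          ENNReal.ofReal (u 0)} ≤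
      ∑' ℓ, drivingLaw (blockSet e P τ k ℓ) := by
  set V : Set (ℤ → ℝ) := {u | alphaLen P τ k (maxContextLen τ (letters e P u) (-1)) ≤
    ENNReal.ofReal (u 0)} with hV
  have hVm : MeasurableSet V := measurableSet_le
    ((measurable_from_top (f := alphaLen P τ k)).comp (measurable_maxContextLen e P hτ (-1)))
    (ENNReal.measurable_ofReal.comp (measurable_pi_apply 0))
  have hVc : ∀ u u' : ℤ → ℝ, (∀ i ≤ 0, u i = u' i) → u ∈ V → u' ∈ V := by
    intro u u' h hu
    simp only [hV, Set.mem_ofPred_eq] at hu ⊢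
    rwa [← h 0 le_rfl, ← maxContextLen_congr_of_forall (Y := letters e P u)
      fun i hi => letters_congr (h i (by omega))]
  have hVlt : drivingLaw V = drivingLaw {u | alphaLen P τ k
      (maxContextLen τ (letters e P u) (-1)) < ENNReal.ofReal (u 0)} := by
    refine measure_congr ?_
    filter_upwards [ae_ofReal_ne_alphaLen P τ k] with u hu
    refine propext ⟨fun h => lt_of_le_of_ne h (hu _).symm, fun h => le_of_lt h⟩
  have hNm := measurable_absThetaBar e P hτ
  have hBm : ∀ n : ℕ, MeasurableSet {u | (n : ℕ∞) ≤ absThetaBar τ (letters e P u)} := fun n =>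
    hNm (.of_discrete (s := Set.Ici (n : ℕ∞)))
  have hind : ∀ n : ℕ, drivingLaw ({u | (n : ℕ∞) ≤ absThetaBar τ (letters e P u)} ∩
      shiftBy (-(n : ℤ)) ⁻¹' V) =
      drivingLaw {u | (n : ℕ∞) ≤ absThetaBar τ (letters e P u)} * drivingLaw V := fun n =>
    drivingLaw_inter_shiftBy (hBm n) hVm
      (fun u u' h hu => natCast_le_absThetaBar_congr hτ
        (fun i hi hi0 => letters_congr (h i ⟨hi, hi0⟩)) hu) hVc
  have htop : drivingLaw {u | absThetaBar τ (letters e P u) = ⊤} = 0 := by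
    have := ae_lt_top (measurable_from_top.comp hNm) hfin.ne
    refine measure_mono_null ?_ this
    intro u hu
    simp only [Set.mem_ofPred_eq] at hu
    simp [hu]
  have hcover : (⋃ ℓ, blockSet e P τ k ℓ)ᶜ ⊆ {u | absThetaBar τ (letters e P u) = ⊤} ∪
      ⋃ n : ℕ, ({u | (n : ℕ∞) ≤ absThetaBar τ (letters e P u)} ∩ shiftBy (-(n : ℤ)) ⁻¹' V) := by
    intro u hu
    by_cases hN : absThetaBar τ (letters e P u) = ⊤
    · exact Or.inl hN
    right
    obtain ⟨ℓ, hℓ⟩ := ENat.ne_top_iff_exists.1 hN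
    have hnot : ¬ ∀ j : ℤ, -(ℓ : ℤ) ≤ j → j ≤ 0 → Fits e P τ k u j := fun h =>
      hu (Set.mem_iUnion.2 ⟨ℓ, hℓ.symm, h⟩)
    push Not at hnot
    obtain ⟨j, hj, hj0, hfit⟩ := hnot
    refine Set.mem_iUnion.2 ⟨j.natAbs, ?_, ?_⟩
    · simp only [Set.mem_ofPred_eq, ← hℓ, Nat.cast_le]
      omega
    · have hle := not_lt.1 fun h => hfit (Or.inr ⟨hk, h⟩)
      simp only [hV, Set.mem_preimage, Set.mem_ofPred_eq, letters_shiftBy, maxContextLen_shift]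
      simp only [shiftBy, zero_add]
      rwa [show (-1 : ℤ) + -(j.natAbs : ℤ) = j - 1 by omega,
        show -(j.natAbs : ℤ) = j by omega]
  have hGm : MeasurableSet (⋃ ℓ, blockSet e P τ k ℓ) :=
    .iUnion fun ℓ => measurableSet_blockSet e P hτ k ℓ
  have hcompl : drivingLaw (⋃ ℓ, blockSet e P τ k ℓ)ᶜ ≤
      (∫⁻ u, (absThetaBar τ (letters e P u) : ℝ≥0∞) ∂drivingLaw + 1) * drivingLaw V := by
    refine (measure_mono hcover).trans ((measure_union_le _ _).trans ?_)
    rw [htop, zero_add]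
    refine (measure_iUnion_le _).trans ?_
    simp_rw [hind]
    rw [ENNReal.tsum_mul_right]
    gcongr
    exact tsum_le_absThetaBar e P hτ
  rw [tsum_blockSet hτ, ← hVlt, tsub_le_iff_right]
  refine (prob_add_prob_compl (μ := drivingLaw) hGm).symm.le.trans ?_
  gcongr

end Wald

/-! ### Reduction of the three regimes to the first one -/

section Regimes

lemma one_le_prod_add_sum {a : ℕ → ℝ≥0∞} (ha : ∀ j, a j ≤ 1) (s : Finset ℕ) :
    1 ≤ ∏ j ∈ s, a j + ∑ j ∈ s, (1 - a j) := by
  classical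
  induction s using Finset.induction_on with
  | empty => simp
  | insert i s hi ih =>
    rw [Finset.prod_insert hi, Finset.sum_insert hi]
    have hp : ∏ j ∈ s, a j ≤ 1 := Finset.prod_le_one' fun j _ => ha j
    calc (1 : ℝ≥0∞) ≤ ∏ j ∈ s, a j + ∑ j ∈ s, (1 - a j) := ih
      _ = (a i + (1 - a i)) * ∏ j ∈ s, a j + ∑ j ∈ s, (1 - a j) := by
          rw [add_tsub_cancel_of_le (ha i), one_mul]
      _ ≤ a i * ∏ j ∈ s, a j + (1 - a i) + ∑ j ∈ s, (1 - a j) := by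
          rw [add_mul]
          gcongr
          exact mul_le_of_le_one_right' hp
      _ = _ := by rw [add_assoc]

/-- If `∑ (1 - aⱼ)` is finite then the products of the `aⱼ` are bounded from below. -/
lemma tsum_prod_eq_top {a : ℕ → ℝ≥0∞} (ha : ∀ j, a j ≤ 1) {c : ℝ≥0∞} (hc : c ≠ 0)
    (hca : ∀ j, c ≤ a j) (hsum : ∑' j, (1 - a j) < ⊤) :
    ∑' k : ℕ, ∏ j ∈ Finset.range (k + 1), a j = ⊤ := by
  obtain ⟨N, hN⟩ : ∃ N, ∑' j, (1 - a (j + N)) < 1 / 2 := by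
    have h := ENNReal.tendsto_sum_nat_add (fun j => 1 - a j) hsum.ne
    exact (h.eventually_lt_const (by norm_num : (0 : ℝ≥0∞) < 1 / 2)).exists
  have hhalf : ∀ n, 1 / 2 ≤ ∏ j ∈ Finset.range n, a (j + N) := by
    intro n
    by_contra! hlt
    have h1 := one_le_prod_add_sum (fun j => ha (j + N)) (Finset.range n)
    refine absurd h1 (not_le.2 ?_)
    calc _ < (1 / 2 : ℝ≥0∞) + 1 / 2 :=
          ENNReal.add_lt_add hlt ((ENNReal.sum_le_tsum _).trans_lt hN)
      _ = 1 := ENNReal.add_halves 1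
  have hle : ∀ k, c ^ N * (1 / 2) ≤ ∏ j ∈ Finset.range (k + 1), a j := by
    intro k
    calc c ^ N * (1 / 2)
        ≤ (∏ j ∈ Finset.range N, a j) * ∏ j ∈ Finset.range (k + 1), a (j + N) := by
          refine mul_le_mul' ?_ (hhalf _)
          calc c ^ N = ∏ _j ∈ Finset.range N, c := by simp
            _ ≤ _ := Finset.prod_le_prod' fun j _ => hca j
      _ = ∏ j ∈ Finset.range (N + (k + 1)), a j := by
          rw [Finset.prod_range_add a N (k + 1)]
          simp only [add_comm N]
      _ ≤ _ := Finset.prod_le_prod_of_subset_of_le_one'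
          (Finset.range_mono (by omega)) fun j _ _ => ha j
  rw [eq_top_iff, ← ENNReal.tsum_const_eq_top_of_ne_zero (α := ℕ) (c := c ^ N * (1 / 2))
    (by simp [hc])]
  exact ENNReal.tsum_le_tsum hle

lemma ExpDecay.tsum_lt_top {c : ℕ → ℝ≥0∞} (h : ExpDecay c) : ∑' k, c k < ⊤ := by
  obtain ⟨D, d, hD, hd, hd1, hle⟩ := h
  refine (ENNReal.tsum_le_tsum hle).trans_lt ?_
  rw [← ENNReal.ofReal_tsum_of_nonneg (fun n => by positivity)
    ((summable_geometric_of_lt_one hd.le hd1).mul_left D)]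
  exact ENNReal.ofReal_lt_top

variable {A : Type*} [MeasurableSpace A] {e : A ↪ ℕ} {P : Kernel (Past A) A} {τ : Set (Str A)}
  {Ω : Type*} [MeasurableSpace Ω] {Pr : Measure Ω} {U : ℤ → Ω → ℝ}

lemma alphaNeg_le_seqA (k : ℕ) : alphaNeg P ≤ seqA e P τ Pr U k := by
  cases k with
  | zero => exact le_rfl
  | succ k => exact le_max_right _ _

lemma IsIIDUniform.measurable_pi (hU : IsIIDUniform Pr U) :
    Measurable fun ω i => U i ω := measurable_pi_iff.2 hU.measurable

lemma IsIIDUniform.map_eq_drivingLaw (hU : IsIIDUniform Pr U) :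
    Pr.map (fun ω i => U i ω) = drivingLaw := by
  rw [hU.indep.map_fun_eq_infinitePi_map hU.measurable, drivingLaw]
  congr 1
  funext i
  exact hU.law i

variable [Countable A]

lemma meanGoodTime_eq (hU : IsIIDUniform Pr U) (hτ : IsContextTree τ) :
    meanGoodTime e P τ Pr U =
      ∫⁻ u, (absThetaBar τ (letters e P u) : ℝ≥0∞) ∂drivingLaw := by
  rw [← hU.map_eq_drivingLaw]
  exact (lintegral_map ((measurable_from_top (f := fun n : ℕ∞ => (n : ℝ≥0∞))).comp
    (measurable_absThetaBar e P hτ)) hU.measurable_pi).symm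

variable [Nonempty A] [MeasurableSingletonClass A] [IsMarkovKernel P]

lemma seqA_le_one (k : ℕ) : seqA e P τ Pr U k ≤ 1 := by
  cases k with
  | zero => exact alphaNeg_le_one P
  | succ k => exact max_le tsub_le_self (alphaNeg_le_one P)

lemma regimeOne_of_regimes (hnull : WeaklyNonNull P)
    (h : RegimeOne e P τ Pr U ∨ RegimeTwo e P τ Pr U ∨ RegimeThree e P τ Pr U) :
    RegimeOne e P τ Pr U := by
  have htwo : RegimeTwo e P τ Pr U → RegimeOne e P τ Pr U := fun h =>
    tsum_prod_eq_top seqA_le_one hnull.ne' alphaNeg_le_seqA h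
  rcases h with h | h | h
  · exact h
  · exact htwo h
  · exact htwo h.2.tsum_lt_top

/-- The sequence `Aₖ` bounds from below the probability that a block needs at most `k` more
symbols. -/
lemma seqA_le_tsum_blockSet (hU : IsIIDUniform Pr U) (hτ : IsContextTree τ)
    (hgood : IsGood e P τ Pr U) (k : ℕ) :
    seqA e P τ Pr U k ≤ ∑' ℓ, drivingLaw (blockSet e P τ k ℓ) := by
  cases k with
  | zero => exact alphaNeg_le_tsum_blockSet 0
  | succ k =>
    refine max_le ?_ (alphaNeg_le_tsum_blockSet _)
    unfold IsGood at hgood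
    rw [meanGoodTime_eq hU hτ] at hgood ⊢
    refine le_trans (le_of_eq ?_) (one_sub_le_tsum_blockSet hτ (Nat.succ_pos k) hgood)
    congr 2
    have hm : MeasurableSet {u | alphaLen P τ (k + 1) (maxContextLen τ (letters e P u) (-1)) <
        ENNReal.ofReal (u 0)} := measurableSet_lt
      ((measurable_from_top (f := alphaLen P τ (k + 1))).comp
        (measurable_maxContextLen e P hτ (-1)))
      (ENNReal.measurable_ofReal.comp (measurable_pi_apply 0))
    rw [← hU.map_eq_drivingLaw, Measure.map_apply hU.measurable_pi hm]
    rfl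

/-- Almost surely there is a renewal for the blocks that end at any time. -/
lemma ae_forall_shiftBy_mem_renewalSet (hU : IsIIDUniform Pr U) (hτ : IsContextTree τ)
    (hgood : IsGood e P τ Pr U) (hreg : RegimeOne e P τ Pr U) :
    ∀ᵐ u ∂drivingLaw, ∀ m : ℤ, shiftBy m u ∈ renewalSet e P τ := by
  have h : ∀ᵐ u ∂drivingLaw, u ∈ renewalSet e P τ :=
    drivingLaw_compl_renewalSet hτ (seqA_le_tsum_blockSet hU hτ hgood) hreg
  rw [ae_all_iff]
  exact fun m => (measurePreserving_shiftBy m).quasiMeasurePreserving.ae h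

end Regimes

/-! ### Coupling from the past -/

section Coalescence

variable {A : Type*} {F : Past A → ℝ → A} {u : ℤ → ℝ}

lemma mem_coalescenceSet_of_le {s s' i : ℤ} (h : s' ≤ s) (hs : s ∈ coalescenceSet F u i) :
    s' ∈ coalescenceSet F u i :=
  ⟨h.trans hs.1, fun x y => by rw [iterF_eq_iterF h hs.1, iterF_eq_iterF h hs.1, hs.2]⟩

lemma iterF_shiftBy (m s i : ℤ) (x : Past A) :
    iterF F (shiftBy m u) s i x = iterF F u (s + m) (i + m) x := by
  rw [iterF, iterF, run_shiftBy, add_sub_add_right_eq_sub]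
  rfl

lemma mem_coalescenceSet_shiftBy {m s i : ℤ} :
    s ∈ coalescenceSet F (shiftBy m u) i ↔ s + m ∈ coalescenceSet F u (i + m) := by
  simp [coalescenceSet, iterF_shiftBy]

variable [Nonempty A]

/-- Any coalescing starting time, and any initial past, give the reconstructed symbol. -/
lemma Phi_eq_iterF {s i : ℤ} (hs : s ∈ coalescenceSet F u i) (x : Past A) :
    Phi F u i = iterF F u s i x := by
  have hθ : theta F u i ∈ coalescenceSet F u i := Int.csSup_mem ⟨s, hs⟩ ⟨i, fun j hj => hj.1⟩
  have hle : s ≤ theta F u i := le_csSup ⟨i, fun j hj => hj.1⟩ hs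
  rw [Phi, iterF_eq_iterF hle hθ.1 x]
  exact hθ.2 _ _

lemma eventually_iterF_eq_Phi {i : ℤ} (h : (coalescenceSet F u i).Nonempty) :
    ∀ᶠ s in atBot, ∀ x, iterF F u s i x = Phi F u i := by
  obtain ⟨s, hs⟩ := h
  filter_upwards [eventually_le_atBot s] with s' hs' x
  exact (Phi_eq_iterF (mem_coalescenceSet_of_le hs' hs) x).symm

/-- The runs that start early enough carry the reconstructed symbols. -/
lemma eventually_run_eq_Phi (h : ∀ i, (coalescenceSet F u i).Nonempty) (i : ℤ) (N : ℕ) :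
    ∀ᶠ s in atBot, ∀ x, ∀ n < N, run F u s x (i + 1 - s).toNat n = pastUpTo (Phi F u) i n := by
  have h1 : ∀ᶠ s in atBot, ∀ n ∈ Finset.range N, ∀ x, iterF F u s (i - n) x = Phi F u (i - n) :=
    (Filter.eventually_all_finset _).2 fun n _ => eventually_iterF_eq_Phi (h _)
  filter_upwards [h1, eventually_le_atBot (i - N)] with s hs hsN x n hn
  rw [run_apply _ _ _ _ (by omega), pastUpTo, ← hs n (Finset.mem_range.2 hn) x]
  congr 1
  omega

lemma Phi_shiftBy (h : ∀ i, (coalescenceSet F u i).Nonempty) (m : ℤ) :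
    Phi F (shiftBy m u) = shiftBy m (Phi F u) := by
  funext i
  obtain ⟨s, hs⟩ := h (i + m)
  have hs' : s - m ∈ coalescenceSet F (shiftBy m u) i := by
    rw [mem_coalescenceSet_shiftBy, sub_add_cancel]
    exact hs
  rw [Phi_eq_iterF hs' (fun _ => Classical.arbitrary A), iterF_shiftBy, sub_add_cancel, shiftBy,
    Phi_eq_iterF hs]

end Coalescence

section Reconstruction

variable {A : Type*} [Nonempty A] [MeasurableSpace A] {e : A ↪ ℕ}
  {P : Kernel (Past A) A} {τ : Set (Str A)} {u : ℤ → ℝ}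

lemma Phi_of_letters {i : ℤ} {a : A} (h : letters e P u i = some a) :
    Phi (updateFn e P) u i = a := updateFn_of_letterOf h _

/-- A renewal before time `i` locates `u_i` below some `ω_K` of the reconstructed past. -/
lemma exists_lt_omegaK (hτ : IsContextTree τ) {i : ℤ} (h : shiftBy i u ∈ renewalSet e P τ) :
    ∃ K, ENNReal.ofReal (u i) < omegaK P (pastUpTo (Phi (updateFn e P) u) (i - 1)) K := by
  obtain ⟨ℓ, ls, hu⟩ := h
  refine ⟨ℓ + ls.length, ?_⟩
  have := lt_omegaK_of_mem_blockSet hτ hu.1 le_rfl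
    (p := pastUpTo (Phi (updateFn e P) u) (i - 1)) fun j hj a ha => ?_
  · simpa [shiftBy] using this
  · refine Phi_of_letters ?_
    rw [← ha, letters_shiftBy]
    simp only
    congr 1
    ring

variable [Countable A] [MeasurableSingletonClass A] [IsMarkovKernel P]

lemma coalescenceSet_nonempty (hτ : IsContextTree τ) {i : ℤ}
    (h : shiftBy i u ∈ renewalSet e P τ) : (coalescenceSet (updateFn e P) u i).Nonempty := by
  obtain ⟨ℓ, ls, hu⟩ := h
  have hT : 0 < totalLen (ℓ :: ls) := by rw [totalLen_cons]; omega
  refine ⟨1 - totalLen (ℓ :: ls) + i, by omega, fun x y => ?_⟩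
  have := run_congr_of_mem_chainSet hτ _ hu x y 0 hT
  rw [run_shiftBy, run_shiftBy] at this
  rw [iterF_eq_run _ _ (by omega), iterF_eq_run _ _ (by omega)]
  convert this using 2 <;> omega

/-- The reconstructed chain is driven by the update function. -/
lemma Phi_eq_updateFn (hτ : IsContextTree τ) (h : ∀ m, shiftBy m u ∈ renewalSet e P τ) (i : ℤ) :
    Phi (updateFn e P) u i =
      updateFn e P (pastUpTo (Phi (updateFn e P) u) (i - 1)) (u i) := by
  have hne := fun m => coalescenceSet_nonempty hτ (h m)
  obtain ⟨K, hK⟩ := exists_lt_omegaK hτ (h i)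
  obtain ⟨s, hs1, hs2⟩ :=
    ((eventually_iterF_eq_Phi (hne i)).and (eventually_run_eq_Phi hne (i - 1) K)).exists
  let x : Past A := fun _ => Classical.arbitrary A
  rw [← hs1 x, iterF]
  refine (updateFn_congr e P (fun n hn => ?_) hK).symm
  rw [← hs2 x n hn, sub_add_cancel]

end Reconstruction

/-! ### Measurability of the update function and of the reconstruction -/

section Measurability

variable {A : Type*} [MeasurableSpace A] [Countable A]

lemma measurableSet_mem_slot (e : A ↪ ℕ) {b : Past A → ℝ≥0∞} {ℓ : Past A → A → ℝ≥0∞}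
    (hb : Measurable b) (hℓ : ∀ a, Measurable fun x => ℓ x a) (a : A) :
    MeasurableSet {q : Past A × ℝ | q.2 ∈ slot e (b q.1) (ℓ q.1) a} := by
  have hlad : Measurable fun x => ladder e (ℓ x) (e a) := by
    refine Measurable.tsum fun c => ?_
    split_ifs
    · exact hℓ c
    · exact measurable_const
  have hL : Measurable fun q : Past A × ℝ => b q.1 + ladder e (ℓ q.1) (e a) :=
    (hb.add hlad).comp measurable_fst
  have hu : Measurable fun q : Past A × ℝ => ENNReal.ofReal q.2 :=
    ENNReal.measurable_ofReal.comp measurable_snd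
  exact (measurableSet_le measurable_const measurable_snd).inter
    ((measurableSet_le hL hu).inter
      (measurableSet_lt hu (hL.add ((hℓ a).comp measurable_fst))))

variable [MeasurableSingletonClass A]

lemma measurable_infP_recent (P : Kernel (Past A) A) (k : ℕ) (a : A) :
    Measurable fun x : Past A => infP P (recent k x) a := by
  have hdisc : ∀ s : Set (Fin k → A), MeasurableSet s := fun s => s.to_countable.measurableSet
  have h1 : Measurable fun y : Fin k → A => infP P (List.ofFn y) a := fun _ _ => hdisc _
  have h2 : Measurable fun (x : Past A) (i : Fin k) => x i :=
    measurable_pi_iff.2 fun i => measurable_pi_apply _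
  have h3 : ∀ x : Past A, recent k x = List.ofFn fun i : Fin k => x i := by
    intro x
    simp [recent, List.ofFn_eq_map, ← List.map_coe_finRange_eq_range, Function.comp_def]
  simp_rw [h3]
  exact h1.comp h2

lemma measurable_omegaK (P : Kernel (Past A) A) (k : ℕ) :
    Measurable fun x : Past A => omegaK P x k :=
  Measurable.tsum fun a => measurable_infP_recent P k a

lemma measurable_pieceLen (P : Kernel (Past A) A) (k : ℕ) (a : A) :
    Measurable fun x : Past A => pieceLen P x k a := by
  cases k with
  | zero => exact measurable_const
  | succ k => exact (measurable_infP_recent P (k + 1) a).sub (measurable_infP_recent P k a)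

lemma measurable_pieceLenInfty (P : Kernel (Past A) A) (a : A) :
    Measurable fun x : Past A => pieceLenInfty P x a :=
  (P.measurable_coe (measurableSet_singleton a)).sub
    (Measurable.iSup fun k => measurable_infP_recent P k a)

lemma measurableSet_mem_letterSet (e : A ↪ ℕ) (P : Kernel (Past A) A) (a : A) :
    MeasurableSet {q : Past A × ℝ | q.2 ∈ letterSet e P q.1 a} := by
  have : {q : Past A × ℝ | q.2 ∈ letterSet e P q.1 a} =
      (⋃ k, {q : Past A × ℝ | q.2 ∈ piece e P q.1 k a}) ∪
        {q : Past A × ℝ | q.2 ∈ pieceInfty e P q.1 a} := by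
    ext q; simp [letterSet]
  rw [this]
  refine (MeasurableSet.iUnion fun k => ?_).union ?_
  · exact measurableSet_mem_slot e (b := fun x => ∑ j ∈ Finset.range k, ∑' b, pieceLen P x j b)
      (Finset.measurable_sum _ fun j _ => Measurable.tsum fun b => measurable_pieceLen P j b)
      (fun b => measurable_pieceLen P k b) a
  · exact measurableSet_mem_slot e (b := fun x => ∑' j, ∑' b, pieceLen P x j b)
      (Measurable.tsum fun j => Measurable.tsum fun b => measurable_pieceLen P j b)
      (fun b => measurable_pieceLenInfty P b) a

/-- The intervals `Iₖ(a | x)`, `k ≤ ∞`, have total length `P(a | x)`. -/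
lemma volume_letterSet (e : A ↪ ℕ) (P : Kernel (Past A) A) [IsMarkovKernel P] (x : Past A)
    (a : A) : volume (letterSet e P x a) = P x {a} := by
  have hm : ∀ k, MeasurableSet (piece e P x k a) := fun k => measurableSet_slot _ _ _ _
  have hm' : MeasurableSet (pieceInfty e P x a) := measurableSet_slot _ _ _ _
  rw [letterSet, measure_union _ hm', measure_iUnion _ hm,
    ← tsum_pieceLen_add]
  · congr 1
    · refine tsum_congr fun k => volume_slot ?_ a
      rw [← Finset.sum_range_succ (fun j => ∑' b, pieceLen P x j b), sum_tsum_pieceLen]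
      exact omegaK_le_one P x k
    · exact volume_slot (tsum_tsum_add P x).le a
  · intro k k' hne
    exact Set.disjoint_left.2 fun u hu hu' => hne (piece_index_unique hu hu')
  · rw [Set.disjoint_iUnion_left]
    exact fun k => Set.disjoint_left.2 fun u hu hu' => disjoint_piece_pieceInfty hu hu'

variable [Nonempty A]

lemma measurable_updateFn (e : A ↪ ℕ) (P : Kernel (Past A) A) [IsMarkovKernel P] :
    Measurable fun q : Past A × ℝ => updateFn e P q.1 q.2 := by
  refine measurable_to_countable' fun a => ?_
  have : (fun q : Past A × ℝ => updateFn e P q.1 q.2) ⁻¹' {a} =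
      {q : Past A × ℝ | q.2 ∈ letterSet e P q.1 a} ∪
        ({q : Past A × ℝ | q.2 ∉ Set.Ico (0 : ℝ) 1} ∩
          {_q | (Classical.epsilon fun _ : A => False) = a}) := by
    ext ⟨x, u⟩
    simp only [Set.mem_preimage, Set.mem_singleton_iff, Set.mem_union, Set.mem_inter_iff,
      Set.mem_ofPred_eq]
    by_cases hu : u ∈ Set.Ico (0 : ℝ) 1
    · obtain ⟨b, hb⟩ := exists_mem_letterSet e P x hu.1 hu.2
      rw [updateFn_eq hb]
      constructor
      · rintro rfl
        exact Or.inl hb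
      · rintro (h | h)
        · exact letterSet_unique hb h
        · exact (h.1 hu).elim
    · rw [updateFn_of_notMem e P x hu]
      constructor
      · exact fun h => Or.inr ⟨hu, h⟩
      · rintro (h | h)
        · exact (hu (mem_Ico_of_mem_letterSet h)).elim
        · exact h.2
  rw [this]
  exact (measurableSet_mem_letterSet e P a).union
    ((measurable_snd measurableSet_Ico).compl.inter (.const _))

lemma measurable_updateFn_apply (e : A ↪ ℕ) (P : Kernel (Past A) A) [IsMarkovKernel P]
    (x : Past A) : Measurable (updateFn e P x) := by
  have h := (measurable_updateFn e P).comp (measurable_prodMk_left (x := x))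
  exact h

/-- Fed with a uniform variable, the update function samples from `P(· | x)`. -/
lemma map_updateFn (e : A ↪ ℕ) (P : Kernel (Past A) A) [IsMarkovKernel P] (x : Past A) :
    uniformLaw.map (updateFn e P x) = P x := by
  have hF := measurable_updateFn_apply e P x
  refine Measure.ext_of_singleton fun a => ?_
  rw [Measure.map_apply hF (measurableSet_singleton a), uniformLaw,
    Measure.restrict_apply (hF (measurableSet_singleton a)), ← volume_letterSet e P x a]
  congr 1
  ext u
  simp only [Set.mem_inter_iff, Set.mem_preimage, Set.mem_singleton_iff]
  constructor
  · rintro ⟨rfl, hu⟩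
    obtain ⟨b, hb⟩ := exists_mem_letterSet e P x hu.1 hu.2
    rwa [updateFn_eq hb]
  · exact fun h => ⟨updateFn_eq h, mem_Ico_of_mem_letterSet h⟩

lemma map_prod_updateFn (e : A ↪ ℕ) (P : Kernel (Past A) A) [IsMarkovKernel P]
    (π : Measure (Past A)) [IsProbabilityMeasure π] :
    (π.prod uniformLaw).map (fun q => (q.1, updateFn e P q.1 q.2)) = π ⊗ₘ P := by
  have hm : Measurable fun q : Past A × ℝ => (q.1, updateFn e P q.1 q.2) :=
    measurable_fst.prodMk (measurable_updateFn e P)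
  ext B hB
  rw [Measure.map_apply hm hB, Measure.prod_apply (hm hB), Measure.compProd_apply hB]
  refine lintegral_congr fun x => ?_
  rw [← map_updateFn e P x,
    Measure.map_apply (measurable_updateFn_apply e P x) (measurable_prodMk_left hB)]
  rfl

end Measurability

section Limit

variable {A : Type*} {F : Past A → ℝ → A}

lemma dependsOn_run (F : Past A → ℝ → A) (s : ℤ) (x : Past A) (n : ℕ) :
    DependsOn (fun u : ℤ → ℝ => run F u s x n) (Set.Ico s (s + n)) := by
  induction n with
  | zero => exact fun u u' _ => rfl
  | succ n ih =>
    intro u u' h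
    simp only [run]
    have h1 : run F u s x n = run F u' s x n := ih fun i hi => h i
      ⟨hi.1, hi.2.trans_le (by push_cast; omega)⟩
    rw [h1, h (s + n) ⟨by omega, by push_cast; omega⟩]

lemma dependsOn_iterF (F : Past A → ℝ → A) (s i : ℤ) (x : Past A) (hs : s ≤ i) :
    DependsOn (fun u : ℤ → ℝ => iterF F u s i x) (Set.Iic i) := by
  intro u u' h
  simp only [iterF]
  have h1 : run F u s x (i - s).toNat = run F u' s x (i - s).toNat :=
    dependsOn_run F s x _ fun j hj => h j (by have := hj.2; simp only [Set.mem_Iic]; omega)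
  rw [h1, h i (le_refl i)]

variable [Nonempty A]

/-- The limit of the symbols at time `i` of the runs that start from a fixed past at
times tending to `-∞`. It agrees almost surely with the reconstructed symbol, but unlike
it, it is obviously measurable and a function of the driving sequence up to time `i`. -/
noncomputable def limitSymbol (F : Past A → ℝ → A) (u : ℤ → ℝ) (i : ℤ) : A :=
  Classical.epsilon fun a => ∀ᶠ s in atBot, iterF F u s i (fun _ => Classical.arbitrary A) = a

lemma limitSymbol_eq {u : ℤ → ℝ} {i : ℤ} {a : A}
    (h : ∀ᶠ s in atBot, iterF F u s i (fun _ => Classical.arbitrary A) = a) :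
    limitSymbol F u i = a := by
  have := Classical.epsilon_spec (p := fun a =>
    ∀ᶠ s in atBot, iterF F u s i (fun _ => Classical.arbitrary A) = a) ⟨a, h⟩
  obtain ⟨s, h1, h2⟩ := (this.and h).exists
  exact h1.symm.trans h2

lemma limitSymbol_eq_Phi {u : ℤ → ℝ} {i : ℤ} (h : (coalescenceSet F u i).Nonempty) :
    limitSymbol F u i = Phi F u i :=
  limitSymbol_eq ((eventually_iterF_eq_Phi h).mono fun _ hs => hs _)

lemma dependsOn_limitSymbol (F : Past A → ℝ → A) (i : ℤ) :
    DependsOn (fun u : ℤ → ℝ => limitSymbol F u i) (Set.Iic i) := by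
  intro u u' h
  simp only [limitSymbol]
  congr 1
  funext a
  refine propext (eventually_congr ?_)
  filter_upwards [eventually_le_atBot i] with s hs
  rw [show iterF F u s i _ = iterF F u' s i _ from dependsOn_iterF F s i _ hs h]

end Limit

section MeasurableRun

variable {A : Type*} [MeasurableSpace A]

lemma measurable_cons : Measurable fun q : A × Past A => cons q.1 q.2 := by
  refine measurable_pi_iff.2 fun n => ?_
  cases n with
  | zero => exact measurable_fst
  | succ n => exact (measurable_pi_apply n).comp measurable_snd

lemma measurable_pastUpTo (n : ℤ) : Measurable fun x : ℤ → A => pastUpTo x n :=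
  measurable_pi_iff.2 fun k => measurable_pi_apply (n - k)

variable {F : Past A → ℝ → A}

lemma measurable_run (hF : Measurable fun q : Past A × ℝ => F q.1 q.2) (s : ℤ) (n : ℕ) :
    Measurable fun q : Past A × (ℤ → ℝ) => run F q.2 s q.1 n := by
  induction n with
  | zero => exact measurable_fst
  | succ n ih =>
    exact measurable_cons.comp
      ((hF.comp (ih.prodMk ((measurable_pi_apply (s + n)).comp measurable_snd))).prodMk ih)

lemma measurable_iterF (hF : Measurable fun q : Past A × ℝ => F q.1 q.2) (s i : ℤ) (x : Past A) :
    Measurable fun u : ℤ → ℝ => iterF F u s i x :=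
  hF.comp (((measurable_run hF s _).comp measurable_prodMk_left).prodMk (measurable_pi_apply i))

lemma measurable_limitSymbol [Nonempty A] [Countable A] [MeasurableSingletonClass A]
    (hF : Measurable fun q : Past A × ℝ => F q.1 q.2) (i : ℤ) :
    Measurable fun u : ℤ → ℝ => limitSymbol F u i := by
  let x : Past A := fun _ => Classical.arbitrary A
  let E : A → Set (ℤ → ℝ) := fun a => {u | ∀ᶠ s in atBot, iterF F u s i x = a}
  have hE : ∀ a, MeasurableSet (E a) := by
    intro a
    have : E a = ⋃ s₀ : ℤ, ⋂ (s : ℤ) (_ : s ≤ s₀), {u | iterF F u s i x = a} := by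
      ext u; simp [E, eventually_atBot]
    rw [this]
    exact .iUnion fun s₀ => .iInter fun s => .iInter fun _ =>
      measurable_iterF hF s i x (measurableSet_singleton a)
  refine measurable_to_countable' fun a => ?_
  have : (fun u => limitSymbol F u i) ⁻¹' {a} =
      E a ∪ ((⋃ b, E b)ᶜ ∩ {_u | (Classical.epsilon fun _ : A => False) = a}) := by
    ext u
    simp only [Set.mem_preimage, Set.mem_singleton_iff, Set.mem_union, Set.mem_inter_iff,
      Set.mem_ofPred_eq, Set.mem_compl_iff, Set.mem_iUnion, not_exists]
    by_cases hu : ∃ b, u ∈ E b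
    · obtain ⟨b, hb⟩ := hu
      rw [limitSymbol_eq hb]
      constructor
      · rintro rfl
        exact Or.inl hb
      · rintro (h | h)
        · exact (limitSymbol_eq hb).symm.trans (limitSymbol_eq h)
        · exact (h.1 b hb).elim
    · push Not at hu
      have hconst : limitSymbol F u i = Classical.epsilon fun _ : A => False := by
        unfold limitSymbol
        congr 1
        funext b
        exact eq_false (hu b)
      rw [hconst]
      exact ⟨fun h => Or.inr ⟨hu, h⟩, fun h => h.elim (fun h => (hu a h).elim) fun h => h.2⟩
  rw [this]
  exact (hE a).union ((MeasurableSet.iUnion hE).compl.inter (.const _))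

end MeasurableRun

/-! ### Compatible and stationary laws -/

section Laws

variable {A : Type*} [MeasurableSpace A]

/-- The law of the past before time `0`. -/
noncomputable def pastLaw (μ : Measure (ℤ → A)) : Measure (Past A) :=
  μ.map fun x => pastUpTo x (-1)

instance (μ : Measure (ℤ → A)) [IsProbabilityMeasure μ] : IsProbabilityMeasure (pastLaw μ) :=
  Measure.isProbabilityMeasure_map (measurable_pastUpTo (-1)).aemeasurable

/-- Compatibility with `P` in terms of the joint law of the past and of the next symbol. -/
lemma isCompatible_iff_map_eq_compProd [Nonempty A] [Countable A] [DiscreteMeasurableSpace A]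
    (P : Kernel (Past A) A) [IsMarkovKernel P] (μ : Measure (ℤ → A)) [IsProbabilityMeasure μ] :
    IsCompatible P μ ↔ μ.map (fun x => (pastUpTo x (-1), x 0)) = pastLaw μ ⊗ₘ P := by
  have hX : Measurable fun x : ℤ → A => pastUpTo x (-1) := measurable_pastUpTo (-1)
  have hY : Measurable fun x : ℤ → A => x 0 := measurable_pi_apply 0
  have hcond : ∀ a : A, (fun x => (condDistrib (fun x : ℤ → A => x 0)
      (fun x : ℤ → A => pastUpTo x (-1)) μ (pastUpTo x (-1))).real {a}) =ᵐ[μ]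
      μ[Set.indicator {x : ℤ → A | x 0 = a} (fun _ => (1 : ℝ)) |
        MeasurableSpace.comap (fun x : ℤ → A => pastUpTo x (-1)) inferInstance] := fun a =>
    condDistrib_ae_eq_condExp hX hY (measurableSet_singleton a)
  rw [pastLaw, ← condDistrib_ae_eq_iff_measure_eq_compProd _ hY.aemeasurable P]
  constructor
  · intro h
    have hm : MeasurableSet {y : Past A | ∀ a : A, (condDistrib (fun x : ℤ → A => x 0)
        (fun x : ℤ → A => pastUpTo x (-1)) μ y) {a} = P y {a}} := by
      have : {y : Past A | ∀ a : A, (condDistrib (fun x : ℤ → A => x 0)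
          (fun x : ℤ → A => pastUpTo x (-1)) μ y) {a} = P y {a}} =
          ⋂ a : A, {y | (condDistrib (fun x : ℤ → A => x 0)
          (fun x : ℤ → A => pastUpTo x (-1)) μ y) {a} = P y {a}} := by
        ext y; simp
      rw [this]
      exact .iInter fun a => measurableSet_eq_fun
        (Kernel.measurable_coe _ (measurableSet_singleton a))
        (Kernel.measurable_coe _ (measurableSet_singleton a))
    have hae : ∀ᵐ y ∂μ.map (fun x : ℤ → A => pastUpTo x (-1)),
        ∀ a : A, (condDistrib (fun x : ℤ → A => x 0)
          (fun x : ℤ → A => pastUpTo x (-1)) μ y) {a} = P y {a} := by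
      rw [ae_map_iff hX.aemeasurable hm, ae_all_iff]
      intro a
      filter_upwards [(hcond a).trans (h a)] with x hx
      exact (measureReal_eq_measureReal_iff).1 hx
    filter_upwards [hae] with y hy
    exact Measure.ext_of_singleton hy
  · intro h a
    refine (hcond a).symm.trans ?_
    filter_upwards [ae_of_ae_map hX.aemeasurable h] with x hx
    rw [hx]

lemma map_pastUpTo_of_isStationaryLaw {μ : Measure (ℤ → A)} (h : IsStationaryLaw μ) (N : ℕ) :
    μ.map (fun x => pastUpTo x ((N : ℤ) - 1)) = pastLaw μ := by
  induction N with
  | zero => simp [pastLaw]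
  | succ N ih =>
    rw [← ih]
    conv_rhs => rw [← h]
    rw [Measure.map_map (measurable_pastUpTo _)
      (measurable_pi_iff.2 fun i => measurable_pi_apply (i + 1))]
    congr 1
    funext x k
    simp only [pastUpTo, Function.comp_apply]
    congr 1
    push_cast
    ring

/-- A stationary law is determined by the law of the past. -/
lemma eq_of_pastLaw_eq {μ ν : Measure (ℤ → A)} [IsProbabilityMeasure μ] [IsProbabilityMeasure ν]
    (hμ : IsStationaryLaw μ) (hν : IsStationaryLaw ν) (h : pastLaw μ = pastLaw ν) : μ = ν := by
  refine ext_of_generate_finite _ (generateFrom_measurableCylinders (α := fun _ : ℤ => A)).symm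
    isPiSystem_measurableCylinders (fun B hB => ?_) (by simp)
  obtain ⟨s, S, hS, rfl⟩ := (mem_measurableCylinders _).1 hB
  obtain ⟨N, hN⟩ : ∃ N : ℕ, ∀ i ∈ s, i ≤ (N : ℤ) - 1 := by
    obtain ⟨M, hM⟩ := s.bddAbove
    exact ⟨(M + 1).toNat, fun i hi => by have := hM hi; omega⟩
  let r : Past A → ℤ → A := fun y i => y ((N : ℤ) - 1 - i).toNat
  have hr : Measurable r := measurable_pi_iff.2 fun i => measurable_pi_apply _
  have hcyl : cylinder s S =
      (fun x : ℤ → A => pastUpTo x ((N : ℤ) - 1)) ⁻¹' (r ⁻¹' cylinder s S) := by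
    ext x
    simp only [Set.mem_preimage, mem_cylinder]
    have : s.restrict x = s.restrict (r (pastUpTo x ((N : ℤ) - 1))) := by
      funext i
      have := hN i i.2
      simp only [Finset.restrict, r, pastUpTo]
      congr 1
      omega
    rw [this]
  have hm : MeasurableSet (r ⁻¹' cylinder s S) := hr (MeasurableSet.cylinder s hS)
  rw [hcyl, ← Measure.map_apply (measurable_pastUpTo _) hm,
    ← Measure.map_apply (measurable_pastUpTo _) hm, map_pastUpTo_of_isStationaryLaw hμ,
    map_pastUpTo_of_isStationaryLaw hν, h]

/-- The law of the past of a stationary compatible law is invariant under one update. -/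
lemma map_cons_updateFn_pastLaw [Nonempty A] [Countable A] [DiscreteMeasurableSpace A] (e : A ↪ ℕ)
    (P : Kernel (Past A) A) [IsMarkovKernel P] {ν : Measure (ℤ → A)} [IsProbabilityMeasure ν]
    (hν : IsStationaryLaw ν) (hc : IsCompatible P ν) :
    ((pastLaw ν).prod uniformLaw).map (fun q => cons (updateFn e P q.1 q.2) q.1) =
      pastLaw ν := by
  have hswap : Measurable fun q : Past A × A => cons q.2 q.1 :=
    measurable_cons.comp measurable_swap
  have h1 := congrArg (Measure.map fun q : Past A × A => cons q.2 q.1)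
    (map_prod_updateFn e P (pastLaw ν))
  rw [Measure.map_map hswap (measurable_fst.prodMk (measurable_updateFn e P)),
    ← (isCompatible_iff_map_eq_compProd P ν).1 hc, Measure.map_map hswap
      ((measurable_pastUpTo (-1)).prodMk (measurable_pi_apply 0))] at h1
  refine h1.trans ?_
  rw [← map_pastUpTo_of_isStationaryLaw hν 1]
  congr 1
  funext x k
  cases k with
  | zero => simp [cons, pastUpTo]
  | succ k =>
    simp only [Function.comp_apply, cons, pastUpTo]
    congr 1
    push_cast
    ring

/-- A law on pasts that is invariant under one update is invariant under runs. -/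
lemma map_run_of_invariant {F : Past A → ℝ → A} (hF : Measurable fun q : Past A × ℝ => F q.1 q.2)
    (π : Measure (Past A)) [IsProbabilityMeasure π]
    (hπ : (π.prod uniformLaw).map (fun q => cons (F q.1 q.2) q.1) = π) (s : ℤ) (n : ℕ) :
    (π.prod drivingLaw).map (fun q => run F q.2 s q.1 n) = π := by
  induction n with
  | zero => simp [run, Measure.map_fst_prod]
  | succ n ih =>
    have hrun := measurable_run hF s n
    have hev : Measurable fun q : Past A × (ℤ → ℝ) => q.2 (s + n) :=
      (measurable_pi_apply (s + n)).comp measurable_snd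
    have hpair : (π.prod drivingLaw).map (fun q => (run F q.2 s q.1 n, q.2 (s + n))) =
        π.prod uniformLaw := by
      refine (Measure.prod_eq fun B C hB hC => ?_).symm
      rw [Measure.map_apply (hrun.prodMk hev) (hB.prod hC),
        Measure.prod_apply ((hrun.prodMk hev) (hB.prod hC))]
      have hsec : ∀ x : Past A, drivingLaw (Prod.mk x ⁻¹'
          ((fun q : Past A × (ℤ → ℝ) => (run F q.2 s q.1 n, q.2 (s + n))) ⁻¹' B ×ˢ C)) =
          drivingLaw (Prod.mk x ⁻¹' ((fun q : Past A × (ℤ → ℝ) => run F q.2 s q.1 n) ⁻¹' B)) *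
            uniformLaw C := by
        intro x
        have hind := indepFun_of_dependsOn (f := fun u : ℤ → ℝ => run F u s x n)
          (g := fun u : ℤ → ℝ => u (s + n)) (hrun.comp measurable_prodMk_left)
          (measurable_pi_apply _) (dependsOn_run F s x n) (T := {s + (n : ℤ)})
          (fun u u' h => h _ rfl) (by simp)
        have := hind.measure_inter_preimage_eq_mul B C hB hC
        have hev' : Measurable fun u : ℤ → ℝ => u (s + n) := measurable_pi_apply _
        rw [← drivingLaw_map_eval (s + n), Measure.map_apply hev' hC]
        exact this
      simp_rw [hsec]
      rw [lintegral_mul_const _ (measurable_measure_prodMk_left (hrun hB)),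
        ← Measure.prod_apply (hrun hB), ← Measure.map_apply hrun hB, ih]
    have hstep : Measurable fun q : Past A × ℝ => cons (F q.1 q.2) q.1 :=
      measurable_cons.comp (hF.prodMk measurable_fst)
    conv_rhs => rw [← hπ, ← hpair, Measure.map_map hstep (hrun.prodMk hev)]
    rfl

end Laws

/-! ### The law of the reconstructed chain -/

section ReconstructedLaw

variable {A : Type*} [Nonempty A] {F : Past A → ℝ → A}

lemma Phi_ae_eq_limitSymbol
    (h : ∀ᵐ u ∂drivingLaw, ∀ i, (coalescenceSet F u i).Nonempty) :
    Phi F =ᵐ[drivingLaw] limitSymbol F := by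
  filter_upwards [h] with u hu
  funext i
  exact (limitSymbol_eq_Phi (hu i)).symm

variable [MeasurableSpace A] [Countable A] [MeasurableSingletonClass A]

lemma aemeasurable_Phi (hF : Measurable fun q : Past A × ℝ => F q.1 q.2)
    (h : ∀ᵐ u ∂drivingLaw, ∀ i, (coalescenceSet F u i).Nonempty) :
    AEMeasurable (Phi F) drivingLaw :=
  ⟨limitSymbol F, measurable_pi_iff.2 (measurable_limitSymbol hF), Phi_ae_eq_limitSymbol h⟩

lemma isStationaryLaw_map_Phi (hF : Measurable fun q : Past A × ℝ => F q.1 q.2)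
    (h : ∀ᵐ u ∂drivingLaw, ∀ i, (coalescenceSet F u i).Nonempty) :
    IsStationaryLaw (drivingLaw.map (Phi F)) := by
  have hm := aemeasurable_Phi hF h
  change (drivingLaw.map (Phi F)).map (shiftBy 1) = _
  rw [AEMeasurable.map_map_of_aemeasurable (measurable_shiftBy 1).aemeasurable hm]
  have hae : shiftBy 1 ∘ Phi F =ᵐ[drivingLaw] Phi F ∘ shiftBy 1 := by
    filter_upwards [h] with u hu
    exact (Phi_shiftBy hu 1).symm
  have hmp := measurePreserving_shiftBy 1
  rw [Measure.map_congr hae, ← AEMeasurable.map_map_of_aemeasurable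
    (by rwa [hmp.map_eq]) hmp.measurable.aemeasurable, hmp.map_eq]

/-- The reconstructed past before time `0` is independent of the driving variable at time `0`. -/
lemma map_past_Phi_prod (hF : Measurable fun q : Past A × ℝ => F q.1 q.2)
    (h : ∀ᵐ u ∂drivingLaw, ∀ i, (coalescenceSet F u i).Nonempty) :
    drivingLaw.map (fun u => (pastUpTo (Phi F u) (-1), u 0)) =
      (pastLaw (drivingLaw.map (Phi F))).prod uniformLaw := by
  have hlim : Measurable (limitSymbol F) := measurable_pi_iff.2 (measurable_limitSymbol hF)
  have hae := Phi_ae_eq_limitSymbol h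
  have hae' : (fun u => (pastUpTo (Phi F u) (-1), u 0)) =ᵐ[drivingLaw]
      fun u => (pastUpTo (limitSymbol F u) (-1), u 0) := by
    filter_upwards [hae] with u hu
    rw [hu]
  have hpast : Measurable fun u => pastUpTo (limitSymbol F u) (-1) :=
    (measurable_pastUpTo (-1)).comp hlim
  have hind : IndepFun (fun u => pastUpTo (limitSymbol F u) (-1)) (fun u : ℤ → ℝ => u 0)
      drivingLaw := by
    refine indepFun_of_dependsOn hpast (measurable_pi_apply 0) (S := Set.Iic (-1)) (T := {0})
      ?_ (fun u u' hu => hu 0 rfl) (by simp)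
    intro u u' hu
    funext k
    exact dependsOn_limitSymbol F _ fun i hi => hu i
      (by simp only [Set.mem_Iic] at hi ⊢; omega)
  rw [Measure.map_congr hae', hind.map_prod_eq_prod_map_map hpast.aemeasurable
    (measurable_pi_apply 0).aemeasurable, drivingLaw_map_eval, pastLaw, Measure.map_congr hae,
    Measure.map_map (measurable_pastUpTo (-1)) hlim]
  rfl

/-- Coupling from the past determines every invariant law: the run from a random past with an
invariant law coincides, on finitely many coordinates, with the reconstructed chain. -/
lemma eq_pastLaw_of_invariant (hF : Measurable fun q : Past A × ℝ => F q.1 q.2)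
    (h : ∀ᵐ u ∂drivingLaw, ∀ i, (coalescenceSet F u i).Nonempty)
    (π : Measure (Past A)) [IsProbabilityMeasure π]
    (hπ : (π.prod uniformLaw).map (fun q => cons (F q.1 q.2) q.1) = π) :
    π = pastLaw (drivingLaw.map (Phi F)) := by
  have hlim : Measurable (limitSymbol F) := measurable_pi_iff.2 (measurable_limitSymbol hF)
  have hpast : Measurable fun u => pastUpTo (limitSymbol F u) (-1) :=
    (measurable_pastUpTo (-1)).comp hlim
  have hlaw : pastLaw (drivingLaw.map (Phi F)) =
      drivingLaw.map fun u => pastUpTo (limitSymbol F u) (-1) := by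
    rw [pastLaw, Measure.map_congr (Phi_ae_eq_limitSymbol h),
      Measure.map_map (measurable_pastUpTo (-1)) hlim]
    rfl
  rw [hlaw]
  refine ext_of_generate_finite _ (generateFrom_measurableCylinders (α := fun _ : ℕ => A)).symm
    isPiSystem_measurableCylinders (fun B hB => ?_) (by simp [Measure.map_apply hpast])
  obtain ⟨t, S, hS, rfl⟩ := (mem_measurableCylinders _).1 hB
  have hB' : MeasurableSet (cylinder t S : Set (Past A)) := MeasurableSet.cylinder t hS
  obtain ⟨N, hN⟩ : ∃ N : ℕ, ∀ i ∈ t, i < N :=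
    ⟨t.sup id + 1, fun i hi => Nat.lt_succ_of_le (Finset.le_sup (f := id) hi)⟩
  have hconst : ∀ s : ℤ, (π.prod drivingLaw)
      ((fun q => run F q.2 s q.1 (-1 + 1 - s).toNat) ⁻¹' cylinder t S) = π (cylinder t S) := by
    intro s
    rw [← Measure.map_apply (measurable_run hF s _) hB', map_run_of_invariant hF π hπ]
  have hlimit : Tendsto (fun s : ℤ => (π.prod drivingLaw)
      ((fun q => run F q.2 s q.1 (-1 + 1 - s).toNat) ⁻¹' cylinder t S)) atBot
      (𝓝 ((π.prod drivingLaw) ((fun q => pastUpTo (limitSymbol F q.2) (-1)) ⁻¹'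
        cylinder t S))) := by
    refine tendsto_measure_of_ae_tendsto_indicator_of_isFiniteMeasure atBot
      ((hpast.comp measurable_snd) hB') (fun s => measurable_run hF s _ hB') ?_
    have hae : ∀ᵐ q ∂(π.prod drivingLaw), ∀ i, (coalescenceSet F q.2 i).Nonempty :=
      Measure.quasiMeasurePreserving_snd.ae h
    filter_upwards [hae] with q hq
    filter_upwards [eventually_run_eq_Phi hq (-1) N] with s hs
    have hrestr : t.restrict (run F q.2 s q.1 (-1 + 1 - s).toNat) =
        t.restrict (pastUpTo (limitSymbol F q.2) (-1)) := by
      funext i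
      simp only [Finset.restrict]
      rw [hs q.1 i (hN i i.2), pastUpTo, pastUpTo, limitSymbol_eq_Phi (hq _)]
    simp only [Set.mem_preimage, mem_cylinder, hrestr]
  simp_rw [hconst] at hlimit
  rw [tendsto_nhds_unique tendsto_const_nhds hlimit, Measure.map_apply hpast hB']
  exact (measurePreserving_snd (μ := π) (ν := drivingLaw)).measure_preimage
    (hpast hB').nullMeasurableSet

end ReconstructedLaw

/-! ### Continuity at the reconstructed past, and compatibility -/

section Continuity

variable {A : Type*} [MeasurableSpace A] [Countable A] [MeasurableSingletonClass A]
  {e : A ↪ ℕ} {P : Kernel (Past A) A} [IsMarkovKernel P] {τ : Set (Str A)}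

lemma isContinuityPoint_of_one_le {x : Past A} (h : 1 ≤ ⨆ k, omegaK P x k) :
    IsContinuityPoint P x := by
  have hsup : ⨆ k, omegaK P x k = 1 := le_antisymm (iSup_le fun k => omegaK_le_one P x k) h
  rw [IsContinuityPoint, ← hsup]
  exact tendsto_atTop_iSup (omegaK_mono P x)

variable [Nonempty A]

lemma ae_coalescenceSet_nonempty (hτ : IsContextTree τ)
    (hren : ∀ᵐ u ∂drivingLaw, ∀ m : ℤ, shiftBy m u ∈ renewalSet e P τ) :
    ∀ᵐ u ∂drivingLaw, ∀ i, (coalescenceSet (updateFn e P) u i).Nonempty := by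
  filter_upwards [hren] with u hu i
  exact coalescenceSet_nonempty hτ (hu i)

/-- The driving variable at time `0` is almost surely below the limit of `ωₖ` at the
reconstructed past, and it is independent of that past; so the limit is `1`. -/
lemma ae_isContinuityPoint (hτ : IsContextTree τ)
    (hren : ∀ᵐ u ∂drivingLaw, ∀ m : ℤ, shiftBy m u ∈ renewalSet e P τ) :
    ∀ᵐ x ∂(drivingLaw.map (Phi (updateFn e P))), IsContinuityPoint P (pastUpTo x (-1)) := by
  have hF := measurable_updateFn e P
  have hcoal := ae_coalescenceSet_nonempty hτ hren
  have hPhi := aemeasurable_Phi hF hcoal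
  have hg : Measurable fun x : Past A => ⨆ k, omegaK P x k :=
    Measurable.iSup fun k => measurable_omegaK P k
  have hset : MeasurableSet {q : Past A × ℝ | ENNReal.ofReal q.2 < ⨆ k, omegaK P q.1 k} :=
    measurableSet_lt (ENNReal.measurable_ofReal.comp measurable_snd) (hg.comp measurable_fst)
  have hpair : AEMeasurable (fun u : ℤ → ℝ => (pastUpTo (Phi (updateFn e P) u) (-1), u 0))
      drivingLaw := ((measurable_pastUpTo (-1)).comp_aemeasurable hPhi).prodMk
        (measurable_pi_apply 0).aemeasurable
  have hlt : ∀ᵐ q ∂((pastLaw (drivingLaw.map (Phi (updateFn e P)))).prod uniformLaw),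
      ENNReal.ofReal q.2 < ⨆ k, omegaK P q.1 k := by
    rw [← map_past_Phi_prod hF hcoal, ae_map_iff hpair hset]
    filter_upwards [hren] with u hu
    obtain ⟨K, hK⟩ := exists_lt_omegaK hτ (hu 0)
    exact hK.trans_le (le_iSup (fun k => omegaK P _ k) K)
  refine ae_of_ae_map (measurable_pastUpTo (-1)).aemeasurable ?_
  filter_upwards [Measure.ae_ae_of_ae_prod hlt] with x hx
  refine isContinuityPoint_of_one_le ?_
  by_contra! hlt1
  set c := ⨆ k, omegaK P x k
  have hc : c.toReal < 1 := by
    have := ENNReal.toReal_strict_mono ENNReal.one_ne_top hlt1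
    simpa using this
  have hnull : uniformLaw (Set.Ico c.toReal 1) = 0 := by
    refine measure_mono_null (fun v hv => ?_) hx
    exact not_lt.2 ((ENNReal.le_ofReal_iff_toReal_le (hlt1.trans_le le_top).ne
      (ENNReal.toReal_nonneg.trans hv.1)).2 hv.1)
  rw [uniformLaw, Measure.restrict_apply measurableSet_Ico, Set.Ico_inter_Ico] at hnull
  simp [hc.not_ge] at hnull

/-- The law of the reconstructed chain is compatible with `P`. -/
lemma isCompatible_map_Phi {A : Type*} [Nonempty A] [MeasurableSpace A] [Countable A]
    [DiscreteMeasurableSpace A] {e : A ↪ ℕ} {P : Kernel (Past A) A} [IsMarkovKernel P]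
    {τ : Set (Str A)} (hτ : IsContextTree τ)
    (hren : ∀ᵐ u ∂drivingLaw, ∀ m : ℤ, shiftBy m u ∈ renewalSet e P τ) :
    IsCompatible P (drivingLaw.map (Phi (updateFn e P))) := by
  have hF := measurable_updateFn e P
  have hcoal := ae_coalescenceSet_nonempty hτ hren
  have hPhi := aemeasurable_Phi hF hcoal
  have : IsProbabilityMeasure (drivingLaw.map (Phi (updateFn e P))) :=
    Measure.isProbabilityMeasure_map hPhi
  have hpair : AEMeasurable (fun u : ℤ → ℝ => (pastUpTo (Phi (updateFn e P) u) (-1), u 0))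
      drivingLaw := ((measurable_pastUpTo (-1)).comp_aemeasurable hPhi).prodMk
        (measurable_pi_apply 0).aemeasurable
  rw [isCompatible_iff_map_eq_compProd, ← map_prod_updateFn e P, ← map_past_Phi_prod hF hcoal,
    AEMeasurable.map_map_of_aemeasurable (measurable_fst.prodMk hF).aemeasurable hpair,
    AEMeasurable.map_map_of_aemeasurable
      ((measurable_pastUpTo (-1)).prodMk (measurable_pi_apply 0)).aemeasurable hPhi]
  refine Measure.map_congr ?_
  filter_upwards [hren] with u hu
  simp only [Function.comp_apply]
  rw [Phi_eq_updateFn hτ hu 0]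
  rfl

end Continuity

end ChainCFTP

open ChainCFTP
theorem corollary1 {A : Type*} [Nonempty A] [MeasurableSpace A] [DiscreteMeasurableSpace A]
    (e : A ↪ ℕ) (P : Kernel (Past A) A) [IsMarkovKernel P]
    {Ω : Type*} [MeasurableSpace Ω] (Pr : Measure Ω) [IsProbabilityMeasure Pr]
    (U : ℤ → Ω → ℝ) (hU : IsIIDUniform Pr U)
    (hnull : WeaklyNonNull P)
    (τ : Set (Str A)) (hτ : IsSkeleton τ) (hLC : LocallyContinuous P τ)
    (hgood : IsGood e P τ Pr U)
    (hreg : RegimeOne e P τ Pr U ∨ RegimeTwo e P τ Pr U ∨ RegimeThree e P τ Pr U) :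
    (∀ᵐ ω ∂Pr, ∀ i : ℤ, (coalescenceSet (updateFn e P) (fun j => U j ω) i).Nonempty) ∧
      AEMeasurable (chainX e P U) Pr ∧
      IsStationaryLaw (Pr.map (chainX e P U)) ∧
      IsCompatible P (Pr.map (chainX e P U)) ∧
      (∀ ν : Measure (ℤ → A), IsProbabilityMeasure ν → IsStationaryLaw ν → IsCompatible P ν →
        ν = Pr.map (chainX e P U)) ∧
      (∀ᵐ x ∂(Pr.map (chainX e P U)), IsContinuityPoint P (pastUpTo x (-1))) := by
  have : Countable A := e.injective.countable
  have hτ' := hτ.1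
  have hren := ae_forall_shiftBy_mem_renewalSet hU hτ' hgood (regimeOne_of_regimes hnull hreg)
  have hF := measurable_updateFn e P
  have hcoal := ae_coalescenceSet_nonempty hτ' hren
  have hPhi := aemeasurable_Phi hF hcoal
  have hstat := isStationaryLaw_map_Phi hF hcoal
  have hUm := hU.measurable_pi
  have hUmap := hU.map_eq_drivingLaw
  have hX : AEMeasurable (chainX e P U) Pr :=
    AEMeasurable.comp_aemeasurable (by rwa [hUmap]) hUm.aemeasurable
  have hmap : Pr.map (chainX e P U) = drivingLaw.map (Phi (updateFn e P)) := by
    rw [← hUmap, AEMeasurable.map_map_of_aemeasurable (by rwa [hUmap]) hUm.aemeasurable]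
    rfl
  rw [hmap]
  refine ⟨?_, hX, hstat, isCompatible_map_Phi hτ' hren, fun ν _ hν hc => ?_,
    ae_isContinuityPoint hτ' hren⟩
  · rw [← hUmap] at hcoal
    exact ae_of_ae_map hUm.aemeasurable hcoal
  · have : IsProbabilityMeasure (drivingLaw.map (Phi (updateFn e P))) :=
      Measure.isProbabilityMeasure_map hPhi
    exact eq_of_pastLaw_eq hν hstat (eq_pastLaw_of_invariant hF hcoal (pastLaw ν)
      (map_cons_updateFn_pastLaw e P hν hc))
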